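/- Let $n\ge 1$ and equip $\mathbb C^{n+1}$ with the Hermitian form $\langle v,w\rangle=v_1\overline{w_{n+1}}+v_{n+1}\overline{w_1}+\sum_{j=2}^n v_j\overline{w_j}$. Let $U(1,n)$ be its group of linear isometries, $\mathrm{PU}(1,n)\subset\mathrm{PSL}(n+1,\mathbb C)$ the projectivization of $U(1,n)$, and $\mathbb H^n_{\mathbb C}=\{[w]\in\mathbb{CP}^n:\langle w,w\rangle<0\}$, with boundary $\partial\mathbb H^n_{\mathbb C}$ in $\mathbb{CP}^n$. For $p=[w]$ let $p^\perp=\{[v]\in\mathbb{CP}^n:\langle v,w\rangle=0\}$. Frances limit set. Let $\Gamma\subset\mathrm{PSL}(n+1,\mathbb C)$ be a discrete subgroup. Consider the sequences $a=(g_k)$ of distinct elements of $\Gamma$ having lifts $\mathbf g_k=\kappa^{(1)}_k\,\mathrm{diag}(\lambda_{1,k},\dots,\lambda_{n+1,k})\,\kappa^{(2)}_k\in\mathrm{SL}(n+1,\mathbb C)$ with $\lambda_{1,k}\ge\dots\ge\lambda_{n+1,k}>0$, where $\kappa^{(1)}_k\to\kappa^{(1)}$ and $\kappa^{(2)}_k\to\kappa^{(2)}$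 in the unitary group $U(n+1)$, $\lambda_{1,k}\to\infty$, and each quotient $\lambda_{i,k}/\lambda_{i+1,k}$ either converges or tends to $+\infty$. Write $e_i\sim e_j$ if $\lambda_{i,k}/\lambda_{j,k}$ converges to a positive real number. For an index $m\in\{1,\dots,n+1\}$ put $$L^{(m)}_a=\kappa^{(1)}\big[\langle e_i : i\le m \text{ or } e_i\sim e_m\rangle\big],\qquad \Lambda^{(m)}(\Gamma)=\overline{\bigcup_a L_a^{(m)}}\subset\mathbb{CP}^n .$$ The Frances limit set is $\Lambda_{\mathrm F}(\Gamma)=\Lambda^{(m)}(\Gamma)$ with $m=\lceil (n+1)/2\rceil$. Chen–Greenberg limit set. For a discrete $\Gamma\subset \mathrm{PU}(1,n)$, the set $\Lambda_{\mathrm{CG}}(\Gamma)$ consists of the points of $\partial\mathbb H^n_{\mathbb C}$ that are accumulation points of the orbit $\Gamma z$ of a point $z\in\mathbb H^n_{\mathbb C}$. Proposition. Let $\Gamma\subset\mathrm{PU}(1,n)$ be a discrete subgroup. For every choice of the base point $z\in\mathbb H^n_{\mathbb C}$ in the definition of $\Lambda_{\mathrm{CG}}(\Gamma)$, $$\Lambda_{\mathrm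 F}(\Gamma)=\bigcup_{p\in\Lambda_{\mathrm{CG}}(\Gamma)}p^\perp ,$$ and for each $p\in\Lambda_{\mathrm{CG}}(\Gamma)$ the set $p^\perp$ is the unique complex projective hyperplane tangent to $\partial\mathbb H^n_{\mathbb C}$ at $p$ (that is, passing through $p$ and with lift contained in the kernel of the real differential of $w\mapsto\langle w,w\rangle$ at every lift of $p$). If $n\ne 2$, the same equality holds with $\Lambda^{(m)}(\Gamma)$, $m=\lfloor (n+1)/2\rfloor$, in place of $\Lambda_{\mathrm F}(\Gamma)$. -/

import Mathlib

open Filter Topology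
open scoped LinearAlgebra.Projectivization MatrixGroups ComplexConjugate

noncomputable section

/-- The topology of `ℂℙⁿ`: the quotient topology from the nonzero vectors of `ℂⁿ⁺¹`. -/
instance projectivizationTopology (n : ℕ) : TopologicalSpace (ℙ ℂ (Fin (n + 1) → ℂ)) :=
  inferInstanceAs (TopologicalSpace (Quotient (projectivizationSetoid ℂ (Fin (n + 1) → ℂ))))

/-- The projectivization `[W] ⊆ ℂℙⁿ` of a linear subspace `W ⊆ ℂⁿ⁺¹`. -/
def projSet {n : ℕ} (W : Submodule ℂ (Fin (n + 1) → ℂ)) : Set (ℙ ℂ (Fin (n + 1) → ℂ)) :=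
  {p | p.submodule ≤ W}

/-! ### Complex hyperbolic space -/

/-- The Hermitian form
`⟨u, v⟩ = u₁ conj(vₙ₊₁) + uₙ₊₁ conj(v₁) + ∑_{j=2}^{n} uⱼ conj(vⱼ)` on `ℂⁿ⁺¹`
(coordinates are numbered from `0` to `n` in the code). -/
def hermForm {n : ℕ} (u v : Fin (n + 1) → ℂ) : ℂ :=
  u 0 * conj (v (Fin.last n)) + u (Fin.last n) * conj (v 0) +
    ∑ j ∈ Finset.Ioo 0 (Fin.last n), u j * conj (v j)

/-- The real-valued quadratic function `w ↦ ⟨w, w⟩`. -/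
def hermNorm {n : ℕ} (w : Fin (n + 1) → ℂ) : ℝ := (hermForm w w).re

/-- The group `U(1,n)` of the invertible matrices that preserve the Hermitian form. -/
def unitaryGroupOneN (n : ℕ) : Subgroup (GL (Fin (n + 1)) ℂ) where
  carrier := {g | ∀ u v : Fin (n + 1) → ℂ,
    hermForm ((g : Matrix (Fin (n + 1)) (Fin (n + 1)) ℂ).mulVec u)
      ((g : Matrix (Fin (n + 1)) (Fin (n + 1)) ℂ).mulVec v) = hermForm u v}
  one_mem' := by intro u v; simp
  mul_mem' := by
    intro a b ha hb u v
    have h := ha ((b : Matrix (Fin (n + 1)) (Fin (n + 1)) ℂ).mulVec u)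
      ((b : Matrix (Fin (n + 1)) (Fin (n + 1)) ℂ).mulVec v)
    rw [Matrix.mulVec_mulVec, Matrix.mulVec_mulVec, hb u v] at h
    simpa using h
  inv_mem' := by
    intro a ha u v
    have h := ha ((a⁻¹ : GL (Fin (n + 1)) ℂ).1.mulVec u) ((a⁻¹ : GL (Fin (n + 1)) ℂ).1.mulVec v)
    rw [Matrix.mulVec_mulVec, Matrix.mulVec_mulVec, Units.mul_inv, Matrix.one_mulVec,
      Matrix.one_mulVec] at h
    exact h.symm

/-- The group `PU(1,n)`, the projectivization of `U(1,n)`, as a subgroup of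
`PSL(n+1,ℂ) = PGL(n+1,ℂ)`: the classes of the matrices of determinant one that are
proportional to an element of `U(1,n)`. -/
def projUnitaryGroup (n : ℕ) : Subgroup PSL(n + 1, ℂ) :=
  ((unitaryGroupOneN n).map Matrix.ProjGenLinGroup.mk).comap
    Matrix.ProjectiveSpecialLinearGroup.toPGL

/-- The complex hyperbolic space (the unit complex ball) `{[w] : ⟨w, w⟩ < 0} ⊆ ℂℙⁿ`. Its
boundary `∂ℍⁿ` is its topological frontier in `ℂℙⁿ`. -/
def complexHyperbolicSpace (n : ℕ) : Set (ℙ ℂ (Fin (n + 1) → ℂ)) :=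
  {p | hermNorm p.rep < 0}

/-- The orthogonal complement `p^⊥` of a point `p` for the Hermitian form, as a linear
subspace of `ℂⁿ⁺¹`. -/
def polar {n : ℕ} (p : ℙ ℂ (Fin (n + 1) → ℂ)) : Submodule ℂ (Fin (n + 1) → ℂ) where
  carrier := {v | ∀ w ∈ p.submodule, hermForm v w = 0}
  zero_mem' := by intro w _; simp [hermForm]
  add_mem' := by
    intro a b ha hb w hw
    have h1 := ha w hw
    have h2 := hb w hw
    unfold hermForm at *
    simp only [Pi.add_apply, add_mul, Finset.sum_add_distrib]
    linear_combination h1 + h2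
  smul_mem' := by
    intro c a ha w hw
    have h1 := ha w hw
    unfold hermForm at *
    simp only [Pi.smul_apply, smul_eq_mul, mul_assoc, ← Finset.mul_sum]
    linear_combination c * h1

/-- `[W]` is a complex hyperplane of `ℂℙⁿ` tangent at `p` to the real hypersurface
`{[w] : ⟨w, w⟩ = 0}`: it passes through `p` and its directions are annihilated by the
real differential of `w ↦ ⟨w, w⟩` at the lifts of `p`. -/
def IsTangentHyperplane {n : ℕ} (W : Submodule ℂ (Fin (n + 1) → ℂ))
    (p : ℙ ℂ (Fin (n + 1) → ℂ)) : Prop :=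
  Module.finrank ℂ W = n ∧ p.submodule ≤ W ∧
    ∀ w ∈ p.submodule, w ≠ 0 → ∀ v ∈ W, fderiv ℝ hermNorm w v = 0

/-- The Chen–Greenberg limit set of `Γ`, computed from the base point `z` of complex hyperbolic
space: the points of `∂ℍⁿ` that are accumulation points of the orbit of `z`. -/
def chenGreenbergLimitSet {n : ℕ} (Γ : Subgroup PSL(n + 1, ℂ)) (z : ℙ ℂ (Fin (n + 1) → ℂ)) :
    Set (ℙ ℂ (Fin (n + 1) → ℂ)) :=
  {p | p ∈ frontier (complexHyperbolicSpace n) ∧ AccPt p (𝓟 (MulAction.orbit Γ z))}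

/-! ### The Frances limit set -/

/-- A sequence of distinct elements of `Γ` that tends simply to infinity: lifts
`A k ∈ SL(n+1,ℂ)` of its elements have Cartan (singular value) decompositions
`A k = κ₁ k * μ k * κ₂ k` whose unitary factors converge, whose Cartan projection `μ k`
(the diagonal matrix of the singular values in decreasing order) tends to infinity, and such
that every quotient of consecutive singular values either converges or tends to infinity. -/
structure SimplyDivergentSequence {n : ℕ} (Γ : Subgroup PSL(n + 1, ℂ)) where
  /-- The lifts to `SL(n+1,ℂ)`. -/
  lift : ℕ → Matrix.SpecialLinearGroup (Fin (n + 1)) ℂ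
  mem : ∀ k, (lift k : PSL(n + 1, ℂ)) ∈ Γ
  distinct : Function.Injective fun k => (lift k : PSL(n + 1, ℂ))
  /-- The left unitary factors. -/
  κ₁ : ℕ → Matrix (Fin (n + 1)) (Fin (n + 1)) ℂ
  /-- The right unitary factors. -/
  κ₂ : ℕ → Matrix (Fin (n + 1)) (Fin (n + 1)) ℂ
  /-- The singular values. -/
  sv : ℕ → Fin (n + 1) → ℝ
  κ₁_unitary : ∀ k, κ₁ k ∈ Matrix.unitaryGroup (Fin (n + 1)) ℂ
  κ₂_unitary : ∀ k, κ₂ k ∈ Matrix.unitaryGroup (Fin (n + 1)) ℂ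
  sv_pos : ∀ k i, 0 < sv k i
  sv_antitone : ∀ k, Antitone (sv k)
  decomposition : ∀ k, (lift k : Matrix (Fin (n + 1)) (Fin (n + 1)) ℂ) =
    κ₁ k * Matrix.diagonal (fun i => (sv k i : ℂ)) * κ₂ k
  /-- The limit of the left unitary factors. -/
  κ₁Lim : Matrix (Fin (n + 1)) (Fin (n + 1)) ℂ
  /-- The limit of the right unitary factors. -/
  κ₂Lim : Matrix (Fin (n + 1)) (Fin (n + 1)) ℂ
  tendsto_κ₁ : Tendsto κ₁ atTop (𝓝 κ₁Lim)
  tendsto_κ₂ : Tendsto κ₂ atTop (𝓝 κ₂Lim)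
  tendsto_sv : Tendsto (fun k => sv k 0) atTop atTop
  quotients : ∀ i : Fin n,
    (∃ c : ℝ, Tendsto (fun k => sv k i.castSucc / sv k i.succ) atTop (𝓝 c)) ∨
      Tendsto (fun k => sv k i.castSucc / sv k i.succ) atTop atTop

namespace SimplyDivergentSequence

variable {n : ℕ} {Γ : Subgroup PSL(n + 1, ℂ)}

/-- The equivalence relation `eᵢ ∼ eⱼ`: the quotient of the `i`-th and `j`-th singular values
converges to a positive real number. Its classes are the blocks `𝒜₁, …, 𝒜ₘ`, which consist
of consecutive indices. -/
def SameBlock (a : SimplyDivergentSequence Γ) (i j : Fin (n + 1)) : Prop :=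
  ∃ c : ℝ, 0 < c ∧ Tendsto (fun k => a.sv k i / a.sv k j) atTop (𝓝 c)

/-- The subspace `L_a` for the middle index `m`: the image under the limit of the left unitary
factors of the flag element `V_s = ⟨𝒜₁, …, 𝒜ₛ⟩`, where `𝒜ₛ` is the block that contains
the basis vector with index `m`. -/
def limitSubspace (a : SimplyDivergentSequence Γ) (m : Fin (n + 1)) :
    Submodule ℂ (Fin (n + 1) → ℂ) :=
  Submodule.span ℂ {v | ∃ i : Fin (n + 1), (i ≤ m ∨ a.SameBlock i m) ∧
    v = a.κ₁Lim.mulVec (Pi.single i 1)}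

end SimplyDivergentSequence

/-- The limit set obtained from the middle index `m`: the closure of the union of the projective
subspaces `L_a` over the sequences `a` of distinct elements of `Γ` that tend simply to
infinity. -/
def francesLimitSetOfIndex {n : ℕ} (m : Fin (n + 1)) (Γ : Subgroup PSL(n + 1, ℂ)) :
    Set (ℙ ℂ (Fin (n + 1) → ℂ)) :=
  closure (⋃ a : SimplyDivergentSequence Γ, projSet (a.limitSubspace m))

/-- The middle index `⌈(n+1)/2⌉ = ⌊n/2⌋ + 1` of `1, …, n+1`, numbered from `0`. -/
def middleIndex (n : ℕ) : Fin (n + 1) := ⟨n / 2, by omega⟩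

/-- The index `⌊(n+1)/2⌋` of `1, …, n+1` (for `n ≥ 1`), numbered from `0`. It agrees with
the middle index if `n` is odd and precedes it if `n` is even. -/
def lowerMiddleIndex (n : ℕ) : Fin (n + 1) := ⟨(n + 1) / 2 - 1, by omega⟩

/-- The Frances limit set `Λ_F(Γ)`. -/
def francesLimitSet {n : ℕ} (Γ : Subgroup PSL(n + 1, ℂ)) : Set (ℙ ℂ (Fin (n + 1) → ℂ)) :=
  francesLimitSetOfIndex (middleIndex n) Γ

end

/-! The whole proof rests on the singular values of an isometry. Let `J` be the matrix of the form
and `A = K₁ D K₂` a singular value decomposition of an isometry. From `Aᴴ J A = J = A J Aᴴ` one gets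
`D M D = N` and `D N D = M`, where `M` and `N` are the matrices of the form on the columns of `K₁`
and of `K₂ᴴ`. Hence columns `i` and `j` are orthogonal for the form unless `s i * s j = 1`. Two
singular values on the same side of 1 would give two independent, orthogonal isotropic vectors,
which the signature forbids. So an isometry with largest singular value `λ > 1` has singular values
`λ, 1, …, 1, λ⁻¹` (`PreservesHermForm.singular_values`).

Along a simply divergent sequence `a`, the block of a middle index therefore ends just before the
last index. So `L_a` is spanned by the first `n` columns of the limit of `κ₁`. All of these are
orthogonal to the first column, which represents the attractor of `a`, and a dimension count
identifies `L_a` with the polar of the attractor (`limitSubspace_eq_polar`).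

Divided by `λ`, the lifts converge to a rank-one matrix with image the attractor and with no
negative vector in its kernel. Every orbit in hyperbolic space thus converges to the attractor
(`tendsto_lift_smul`), whatever the base point. Conversely, discreteness forces `λ → ∞` along
distinct elements, so a compactness argument realizes every Chen–Greenberg limit point as an
attractor (`exists_attractor_eq`). The closure adds nothing, because the polars of a closed set of
points have closed union (`isClosed_iUnion_polar`). -/

open Matrix

noncomputable section

/-! ### The Hermitian form and its matrix -/

/-- The matrix of the Hermitian form `hermForm`. -/
def formMatrix (n : ℕ) : Matrix (Fin (n + 1)) (Fin (n + 1)) ℂ :=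
  Equiv.Perm.permMatrix ℂ (Equiv.swap 0 (Fin.last n))

lemma formMatrix_mulVec (n : ℕ) (v : Fin (n + 1) → ℂ) (i : Fin (n + 1)) :
    (formMatrix n *ᵥ v) i = v (Equiv.swap 0 (Fin.last n) i) := by
  simp [formMatrix, Matrix.permMatrix_mulVec]

lemma formMatrix_mul_self (n : ℕ) : formMatrix n * formMatrix n = 1 := by
  rw [formMatrix, ← Matrix.permMatrix_mul]
  simp

lemma formMatrix_conjTranspose (n : ℕ) : (formMatrix n)ᴴ = formMatrix n := by
  rw [formMatrix, Matrix.conjTranspose_permMatrix]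
  simp

lemma hermForm_eq_dotProduct {n : ℕ} (hn : 1 ≤ n) (u v : Fin (n + 1) → ℂ) :
    hermForm u v = star v ⬝ᵥ (formMatrix n *ᵥ u) := by
  have h0 : (0 : Fin (n + 1)) ≠ Fin.last n := by
    intro h; have := congrArg Fin.val h; simp at this; omega
  have hu : (Finset.univ : Finset (Fin (n + 1))) =
      insert 0 (insert (Fin.last n) (Finset.Ioo 0 (Fin.last n))) := by
    ext i
    simp only [Finset.mem_univ, Finset.mem_insert, Finset.mem_Ioo, true_iff]
    rcases eq_or_ne i 0 with h | h
    · exact Or.inl h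
    rcases eq_or_ne i (Fin.last n) with h' | h'
    · exact Or.inr (Or.inl h')
    · exact Or.inr (Or.inr ⟨Fin.pos_iff_ne_zero.mpr h, Fin.lt_last_iff_ne_last.mpr h'⟩)
  rw [dotProduct, hu, Finset.sum_insert (by simp [h0]), Finset.sum_insert (by simp), hermForm]
  have : ∀ j ∈ Finset.Ioo 0 (Fin.last n),
      star v j * (formMatrix n *ᵥ u) j = u j * conj (v j) := by
    intro j hj
    rw [Finset.mem_Ioo] at hj
    rw [formMatrix_mulVec, Equiv.swap_apply_of_ne_of_ne hj.1.ne' hj.2.ne]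
    simp [mul_comm]
  rw [Finset.sum_congr rfl this, formMatrix_mulVec, formMatrix_mulVec]
  simp only [Equiv.swap_apply_left, Equiv.swap_apply_right, Pi.star_apply, RCLike.star_def]
  ring

lemma hermForm_conj_symm {n : ℕ} (u v : Fin (n + 1) → ℂ) :
    conj (hermForm u v) = hermForm v u := by
  simp only [hermForm, map_add, map_mul, map_sum, Complex.conj_conj]
  rw [Finset.sum_congr rfl fun j _ => mul_comm (conj (u j)) (v j)]
  ring

lemma hermForm_add_left {n : ℕ} (u u' v : Fin (n + 1) → ℂ) :
    hermForm (u + u') v = hermForm u v + hermForm u' v := by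
  simp only [hermForm, Pi.add_apply, add_mul, Finset.sum_add_distrib]
  ring

lemma hermForm_smul_left {n : ℕ} (c : ℂ) (u v : Fin (n + 1) → ℂ) :
    hermForm (c • u) v = c * hermForm u v := by
  simp only [hermForm, Pi.smul_apply, smul_eq_mul, mul_assoc, ← Finset.mul_sum]
  ring

lemma hermForm_add_right {n : ℕ} (u v v' : Fin (n + 1) → ℂ) :
    hermForm u (v + v') = hermForm u v + hermForm u v' := by
  rw [← hermForm_conj_symm, hermForm_add_left, map_add, hermForm_conj_symm, hermForm_conj_symm]

lemma hermForm_smul_right {n : ℕ} (c : ℂ) (u v : Fin (n + 1) → ℂ) :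
    hermForm u (c • v) = conj c * hermForm u v := by
  rw [← hermForm_conj_symm, hermForm_smul_left, map_mul, hermForm_conj_symm]

lemma hermForm_self {n : ℕ} (u : Fin (n + 1) → ℂ) : hermForm u u = (hermNorm u : ℂ) :=
  (Complex.conj_eq_iff_re.mp (hermForm_conj_symm u u)).symm

lemma hermNorm_smul {n : ℕ} (c : ℂ) (u : Fin (n + 1) → ℂ) :
    hermNorm (c • u) = ‖c‖ ^ 2 * hermNorm u := by
  have h : (hermNorm (c • u) : ℂ) = ((‖c‖ ^ 2 * hermNorm u : ℝ) : ℂ) := by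
    rw [← hermForm_self, hermForm_smul_left, hermForm_smul_right, hermForm_self, ← mul_assoc,
      Complex.mul_conj']
    push_cast; ring
  exact_mod_cast h

lemma continuous_hermForm {n : ℕ} :
    Continuous fun x : (Fin (n + 1) → ℂ) × (Fin (n + 1) → ℂ) => hermForm x.1 x.2 := by
  unfold hermForm
  fun_prop

lemma continuous_hermNorm {n : ℕ} : Continuous (hermNorm : (Fin (n + 1) → ℂ) → ℝ) :=
  Complex.continuous_re.comp (continuous_hermForm.comp (continuous_id.prodMk continuous_id))

/-! ### The signature of the form -/

/-- On the hyperplane `y 0 = y (Fin.last n)` the form is `2|y₀|² + ∑ |yⱼ|²`, hence positive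
definite. This is the only input about the signature. -/
lemma eq_zero_of_hermNorm_nonpos {n : ℕ} {y : Fin (n + 1) → ℂ} (hy : hermNorm y ≤ 0)
    (h : y 0 = y (Fin.last n)) : y = 0 := by
  have e : hermNorm y = 2 * Complex.normSq (y 0) +
      ∑ j ∈ Finset.Ioo 0 (Fin.last n), Complex.normSq (y j) := by
    have : (hermNorm y : ℂ) = ((2 * Complex.normSq (y 0) +
      ∑ j ∈ Finset.Ioo 0 (Fin.last n), Complex.normSq (y j) : ℝ) : ℂ) := by
      rw [← hermForm_self, hermForm, ← h]
      simp only [Complex.mul_conj]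
      push_cast; ring
    exact_mod_cast this
  have hs : 0 ≤ ∑ j ∈ Finset.Ioo 0 (Fin.last n), Complex.normSq (y j) :=
    Finset.sum_nonneg fun j _ => Complex.normSq_nonneg _
  have h0 := Complex.normSq_nonneg (y 0)
  have hs0 : ∑ j ∈ Finset.Ioo 0 (Fin.last n), Complex.normSq (y j) = 0 := by linarith
  have hy0 : y 0 = 0 := Complex.normSq_eq_zero.mp (by linarith)
  rw [Finset.sum_eq_zero_iff_of_nonneg fun j _ => Complex.normSq_nonneg _] at hs0
  funext j
  rcases eq_or_ne j 0 with rfl | hj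
  · exact hy0
  rcases eq_or_ne j (Fin.last n) with rfl | hj'
  · rw [← h]; exact hy0
  exact Complex.normSq_eq_zero.mp (hs0 j (Finset.mem_Ioo.mpr
    ⟨Fin.pos_iff_ne_zero.mpr hj, Fin.lt_last_iff_ne_last.mpr hj'⟩))

/-- Two orthogonal vectors that are not positive are proportional. -/
lemma exists_smul_eq_of_hermForm_eq_zero {n : ℕ} {w x : Fin (n + 1) → ℂ} (hw0 : w ≠ 0)
    (hw : hermNorm w ≤ 0) (hx : hermNorm x ≤ 0) (h : hermForm w x = 0) : ∃ c : ℂ, x = c • w := by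
  have hb : w 0 - w (Fin.last n) ≠ 0 := fun hb =>
    hw0 (eq_zero_of_hermNorm_nonpos hw (sub_eq_zero.mp hb))
  have h' : hermForm x w = 0 := by rw [← hermForm_conj_symm, h, map_zero]
  -- This `c` puts `x - c • w` in the positive definite hyperplane, while orthogonality keeps its
  -- norm nonpositive.
  set c : ℂ := (x 0 - x (Fin.last n)) / (w 0 - w (Fin.last n)) with hc
  have hy : hermNorm (x + (-c) • w) = hermNorm x + ‖c‖ ^ 2 * hermNorm w := by
    have : (hermNorm (x + (-c) • w) : ℂ) = ((hermNorm x + ‖c‖ ^ 2 * hermNorm w : ℝ) : ℂ) := by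
      rw [← hermForm_self]
      simp only [hermForm_add_left, hermForm_add_right, hermForm_smul_left, hermForm_smul_right,
        h, h']
      rw [hermForm_self, hermForm_self, mul_zero, add_zero, zero_add, ← mul_assoc, Complex.conj_mul',
        norm_neg]
      push_cast; ring
    exact_mod_cast this
  have hz : x + (-c) • w = 0 := by
    apply eq_zero_of_hermNorm_nonpos
    · rw [hy]
      nlinarith [sq_nonneg ‖c‖]
    · simp only [Pi.add_apply, Pi.smul_apply, smul_eq_mul]
      have : c * (w 0 - w (Fin.last n)) = x 0 - x (Fin.last n) := div_mul_cancel₀ _ hb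
      linear_combination -this
  exact ⟨c, by rw [neg_smul] at hz; exact add_neg_eq_zero.mp hz⟩

lemma hermForm_ne_zero_of_neg {n : ℕ} {w x : Fin (n + 1) → ℂ} (hw : hermNorm w < 0)
    (hx0 : x ≠ 0) (hx : hermNorm x ≤ 0) : hermForm w x ≠ 0 := by
  intro h
  have hw0 : w ≠ 0 := by rintro rfl; simp [hermNorm, hermForm] at hw
  obtain ⟨c, rfl⟩ := exists_smul_eq_of_hermForm_eq_zero hw0 hw.le hx h
  rw [hermForm_smul_right, hermForm_self, mul_eq_zero] at h
  rcases h with h | h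
  · rw [map_eq_zero] at h
    simp [h] at hx0
  · exact hw.ne (by exact_mod_cast h)

/-! ### Isometries and their singular values -/

/-- The matrix `A` preserves the Hermitian form. -/
def PreservesHermForm {n : ℕ} (A : Matrix (Fin (n + 1)) (Fin (n + 1)) ℂ) : Prop :=
  ∀ u v, hermForm (A *ᵥ u) (A *ᵥ v) = hermForm u v

lemma PreservesHermForm.hermNorm {n : ℕ} {A : Matrix (Fin (n + 1)) (Fin (n + 1)) ℂ}
    (h : PreservesHermForm A) (u : Fin (n + 1) → ℂ) : hermNorm (A *ᵥ u) = hermNorm u := by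
  rw [_root_.hermNorm, h, _root_.hermNorm]

/-- The form is conjugate-linear in its second argument, so that argument supplies the row index. -/
lemma hermForm_mulVec_single {n : ℕ} (hn : 1 ≤ n) (K : Matrix (Fin (n + 1)) (Fin (n + 1)) ℂ)
    (i j : Fin (n + 1)) :
    hermForm (K *ᵥ Pi.single j 1) (K *ᵥ Pi.single i 1) = (Kᴴ * formMatrix n * K) i j := by
  rw [hermForm_eq_dotProduct hn, star_mulVec, dotProduct_mulVec, vecMul_vecMul, dotProduct_mulVec,
    vecMul_vecMul, dotProduct_single_one, Pi.star_single, star_one, single_one_vecMul]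
  rfl

lemma PreservesHermForm.conjTranspose_mul_mul {n : ℕ} (hn : 1 ≤ n)
    {A : Matrix (Fin (n + 1)) (Fin (n + 1)) ℂ} (h : PreservesHermForm A) :
    Aᴴ * formMatrix n * A = formMatrix n := by
  ext i j
  have h1 := hermForm_mulVec_single hn A i j
  have h2 := hermForm_mulVec_single hn (1 : Matrix (Fin (n + 1)) (Fin (n + 1)) ℂ) i j
  rw [h] at h1
  rw [one_mulVec, one_mulVec, h1] at h2
  simpa using h2

/-- Since `J² = 1`, the identity `Aᴴ J A = J` makes `J Aᴴ J` a left inverse of `A`, hence a right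
inverse. This dual identity controls the right unitary factor. -/
lemma PreservesHermForm.mul_mul_conjTranspose {n : ℕ} (hn : 1 ≤ n)
    {A : Matrix (Fin (n + 1)) (Fin (n + 1)) ℂ} (h : PreservesHermForm A) :
    A * formMatrix n * Aᴴ = formMatrix n := by
  have h1 : (formMatrix n * Aᴴ * formMatrix n) * A = 1 := by
    rw [mul_assoc, mul_assoc, ← mul_assoc Aᴴ, h.conjTranspose_mul_mul hn, formMatrix_mul_self]
  have h2 : A * (formMatrix n * Aᴴ * formMatrix n) = 1 := mul_eq_one_comm.mp h1
  calc A * formMatrix n * Aᴴ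
      = A * (formMatrix n * Aᴴ * formMatrix n) * formMatrix n := by
        simp only [mul_assoc, formMatrix_mul_self, mul_one]
    _ = formMatrix n := by rw [h2, one_mul]

lemma unitary_mulVec_single_ne_zero {m : Type*} [Fintype m] [DecidableEq m] {K : Matrix m m ℂ}
    (hK : K ∈ Matrix.unitaryGroup m ℂ) (i : m) : K *ᵥ Pi.single i 1 ≠ 0 := by
  intro h
  have h2 := congrArg (fun v => Kᴴ *ᵥ v) h
  have h1 : Kᴴ * K = 1 := Matrix.mem_unitaryGroup_iff'.mp hK
  simp only [mulVec_mulVec, h1, one_mulVec, mulVec_zero] at h2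
  simpa using congrFun h2 i

/-- Orthogonal isotropic vectors are proportional, whereas distinct columns of a unitary matrix are
independent. -/
lemma eq_of_null_columns {n : ℕ} {K : Matrix (Fin (n + 1)) (Fin (n + 1)) ℂ}
    (hK : K ∈ Matrix.unitaryGroup (Fin (n + 1)) ℂ) {i j : Fin (n + 1)}
    (hi : hermForm (K *ᵥ Pi.single i 1) (K *ᵥ Pi.single i 1) = 0)
    (hj : hermForm (K *ᵥ Pi.single j 1) (K *ᵥ Pi.single j 1) = 0)
    (hij : hermForm (K *ᵥ Pi.single i 1) (K *ᵥ Pi.single j 1) = 0) : i = j := by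
  obtain ⟨c, hc⟩ := exists_smul_eq_of_hermForm_eq_zero (unitary_mulVec_single_ne_zero hK i)
    (by rw [hermNorm, hi, Complex.zero_re]) (by rw [hermNorm, hj, Complex.zero_re]) hij
  have h1 : Kᴴ * K = 1 := Matrix.mem_unitaryGroup_iff'.mp hK
  have h2 := congrArg (fun v => Kᴴ *ᵥ v) hc
  simp only [mulVec_smul, mulVec_mulVec, h1, one_mulVec] at h2
  by_contra hne
  have := congrFun h2 j
  simp [Pi.single_eq_of_ne (Ne.symm hne)] at this

section SingularValues

variable {n : ℕ} {A K₁ K₂ : Matrix (Fin (n + 1)) (Fin (n + 1)) ℂ} {s : Fin (n + 1) → ℝ}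

lemma PreservesHermForm.column_identities (hn : 1 ≤ n) (hA : PreservesHermForm A)
    (h₁ : K₁ ∈ Matrix.unitaryGroup (Fin (n + 1)) ℂ) (h₂ : K₂ ∈ Matrix.unitaryGroup (Fin (n + 1)) ℂ)
    (hd : A = K₁ * Matrix.diagonal (fun i => (s i : ℂ)) * K₂) (i j : Fin (n + 1)) :
    (s i : ℂ) * (K₁ᴴ * formMatrix n * K₁) i j * s j = (K₂ * formMatrix n * K₂ᴴ) i j ∧
      (s i : ℂ) * (K₂ * formMatrix n * K₂ᴴ) i j * s j = (K₁ᴴ * formMatrix n * K₁) i j := by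
  have u1 : K₁ᴴ * K₁ = 1 := Matrix.mem_unitaryGroup_iff'.mp h₁
  have u2 : K₂ * K₂ᴴ = 1 := Matrix.mem_unitaryGroup_iff.mp h₂
  set D := Matrix.diagonal (fun i => (s i : ℂ)) with hD
  have hDs : Dᴴ = D := by
    rw [hD, diagonal_conjTranspose]; congr 1; funext i; simp
  have e1 := hA.conjTranspose_mul_mul hn
  have e2 := hA.mul_mul_conjTranspose hn
  have f1 : D * (K₁ᴴ * formMatrix n * K₁) * D = K₂ * formMatrix n * K₂ᴴ := by
    conv_rhs => rw [← e1, hd]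
    simp only [conjTranspose_mul, hDs, mul_assoc, u2, mul_one]
    simp only [← mul_assoc, u2, one_mul]
  have f2 : D * (K₂ * formMatrix n * K₂ᴴ) * D = K₁ᴴ * formMatrix n * K₁ := by
    conv_rhs => rw [← e2, hd]
    simp only [conjTranspose_mul, hDs, mul_assoc, u1, mul_one]
    simp only [← mul_assoc, u1, one_mul]
  constructor
  · rw [← f1, hD, mul_diagonal, diagonal_mul]
  · rw [← f2, hD, mul_diagonal, diagonal_mul]

/-- Composing the two column identities multiplies each entry by `(s i * s j)²`. As `s i * s j` is
positive and not 1, the entry vanishes. -/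
lemma PreservesHermForm.column_orthogonal (hn : 1 ≤ n) (hA : PreservesHermForm A)
    (h₁ : K₁ ∈ Matrix.unitaryGroup (Fin (n + 1)) ℂ) (h₂ : K₂ ∈ Matrix.unitaryGroup (Fin (n + 1)) ℂ)
    (hd : A = K₁ * Matrix.diagonal (fun i => (s i : ℂ)) * K₂) (hs : ∀ i, 0 < s i)
    {i j : Fin (n + 1)} (hij : s i * s j ≠ 1) :
    hermForm (K₁ *ᵥ Pi.single i 1) (K₁ *ᵥ Pi.single j 1) = 0 ∧
      hermForm (K₂ᴴ *ᵥ Pi.single i 1) (K₂ᴴ *ᵥ Pi.single j 1) = 0 := by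
  rw [hermForm_mulVec_single hn, hermForm_mulVec_single hn, conjTranspose_conjTranspose]
  obtain ⟨e1, e2⟩ := hA.column_identities hn h₁ h₂ hd j i
  have hp : 0 < s i * s j := mul_pos (hs i) (hs j)
  have hne : ((s i * s j : ℝ) : ℂ) ^ 2 - 1 ≠ 0 := by
    intro h
    have : (s i * s j) ^ 2 - 1 = 0 := by exact_mod_cast h
    rcases mul_eq_zero.mp (by linear_combination this : (s i * s j - 1) * (s i * s j + 1) = 0)
      with h | h
    · exact hij (by linarith)
    · linarith
  push_cast at hne
  constructor
  · refine (mul_eq_zero.mp ?_).resolve_left hne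
    linear_combination e2 + (s i : ℂ) * s j * e1
  · refine (mul_eq_zero.mp ?_).resolve_left hne
    linear_combination e1 + (s i : ℂ) * s j * e2

lemma PreservesHermForm.singular_values (hn : 1 ≤ n) (hA : PreservesHermForm A)
    (h₁ : K₁ ∈ Matrix.unitaryGroup (Fin (n + 1)) ℂ) (h₂ : K₂ ∈ Matrix.unitaryGroup (Fin (n + 1)) ℂ)
    (hd : A = K₁ * Matrix.diagonal (fun i => (s i : ℂ)) * K₂) (hs : ∀ i, 0 < s i)
    (ha : Antitone s) (h0 : 1 < s 0) :
    s 0 * s (Fin.last n) = 1 ∧ ∀ i, 0 < i → i < Fin.last n → s i = 1 := by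
  have orth := fun i j (hij : s i * s j ≠ 1) =>
    (hA.column_orthogonal hn h₁ h₂ hd hs (i := i) (j := j) hij).1
  -- A singular value other than 1 has square other than 1, so its column is isotropic. Two values
  -- on the same side of 1 also have product other than 1.
  have big : ∀ i j, 1 < s i → 1 < s j → i = j := fun i j hi hj =>
    eq_of_null_columns h₁ (orth _ _ (by nlinarith)) (orth _ _ (by nlinarith))
      (orth _ _ (by nlinarith))
  have small : ∀ i j, s i < 1 → s j < 1 → i = j := fun i j hi hj =>
    eq_of_null_columns h₁ (orth _ _ (by nlinarith [hs i])) (orth _ _ (by nlinarith [hs j]))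
      (orth _ _ (by nlinarith [hs i, hs j]))
  -- Otherwise the first row of `K₁ᴴ J K₁` vanishes, although this matrix squares to 1.
  have key : ∃ j, s 0 * s j = 1 := by
    by_contra! hne
    have u1 : K₁ * K₁ᴴ = 1 := Matrix.mem_unitaryGroup_iff.mp h₁
    have u1' : K₁ᴴ * K₁ = 1 := Matrix.mem_unitaryGroup_iff'.mp h₁
    have hM : (K₁ᴴ * formMatrix n * K₁) * (K₁ᴴ * formMatrix n * K₁) = 1 := by
      calc _ = K₁ᴴ * formMatrix n * (K₁ * K₁ᴴ) * formMatrix n * K₁ := by simp only [mul_assoc]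
        _ = K₁ᴴ * (formMatrix n * formMatrix n) * K₁ := by
          rw [u1, mul_one]; simp only [mul_assoc]
        _ = 1 := by rw [formMatrix_mul_self, mul_one, u1']
    have := congrFun (congrFun hM 0) 0
    rw [Matrix.mul_apply, Finset.sum_eq_zero] at this
    · simp at this
    · intro j _
      rw [← hermForm_mulVec_single hn, orth j 0 (by rw [mul_comm]; exact hne j), zero_mul]
  obtain ⟨j, hj⟩ := key
  have hj1 : s j < 1 := by nlinarith [hs j]
  have hl1 : s (Fin.last n) < 1 := lt_of_le_of_lt (ha (Fin.le_last j)) hj1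
  have hjl := small j _ hj1 hl1
  subst hjl
  refine ⟨hj, fun i hi hi' => le_antisymm ?_ ?_⟩
  · by_contra! h
    exact hi.ne' (big i 0 h h0)
  · by_contra! h
    exact hi'.ne (small i _ h hl1)

end SingularValues

/-! ### Polars and tangent hyperplanes -/

open scoped ComplexOrder in
lemma star_dotProduct_self_ne_zero {ι : Type*} [Fintype ι] {v : ι → ℂ} (hv : v ≠ 0) :
    star v ⬝ᵥ v ≠ 0 :=
  mt dotProduct_star_self_eq_zero.mp hv

lemma mem_polar_mk {n : ℕ} {w : Fin (n + 1) → ℂ} (hw : w ≠ 0) {v : Fin (n + 1) → ℂ} :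
    v ∈ polar (Projectivization.mk ℂ w hw) ↔ hermForm v w = 0 := by
  change (∀ x ∈ (Projectivization.mk ℂ w hw).submodule, hermForm v x = 0) ↔ _
  rw [Projectivization.submodule_mk]
  refine ⟨fun h => h w (Submodule.mem_span_singleton_self w), fun h x hx => ?_⟩
  obtain ⟨c, rfl⟩ := Submodule.mem_span_singleton.mp hx
  rw [hermForm_smul_right, h, mul_zero]

lemma mk_mem_projSet {n : ℕ} {w : Fin (n + 1) → ℂ} (hw : w ≠ 0)
    {W : Submodule ℂ (Fin (n + 1) → ℂ)} : Projectivization.mk ℂ w hw ∈ projSet W ↔ w ∈ W := by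
  rw [projSet, Set.mem_ofPred_eq, Projectivization.submodule_mk, Submodule.span_singleton_le_iff_mem]

lemma finrank_polar {n : ℕ} (hn : 1 ≤ n) (p : ℙ ℂ (Fin (n + 1) → ℂ)) :
    Module.finrank ℂ (polar p) = n := by
  induction p using Projectivization.ind with | _ w hw =>
  let f : Module.Dual ℂ (Fin (n + 1) → ℂ) :=
    { toFun := fun v => hermForm v w
      map_add' := fun u v => hermForm_add_left u v w
      map_smul' := fun c v => hermForm_smul_left c v w }
  have hf : f ≠ 0 := by
    intro hf
    -- Nondegeneracy: the functional takes the value `star w ⬝ᵥ w ≠ 0` at `J w`.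
    have h1 : hermForm (formMatrix n *ᵥ w) w = 0 := LinearMap.congr_fun hf _
    rw [hermForm_eq_dotProduct hn, mulVec_mulVec, formMatrix_mul_self, one_mulVec] at h1
    exact star_dotProduct_self_ne_zero hw h1
  have hk : polar (Projectivization.mk ℂ w hw) = LinearMap.ker f := by
    ext v
    rw [mem_polar_mk]
    rfl
  have := Module.Dual.finrank_ker_add_one_of_ne_zero hf
  rw [hk]
  rw [Module.finrank_fin_fun] at this
  omega

/-- Along the line `w + t • v` the function is a quadratic polynomial in `t`, and the derivative at
0 is its linear coefficient. -/
lemma fderiv_hermNorm_apply {n : ℕ} (w v : Fin (n + 1) → ℂ) :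
    fderiv ℝ hermNorm w v = 2 * (hermForm v w).re := by
  have hd : DifferentiableAt ℝ (hermNorm : (Fin (n + 1) → ℂ) → ℝ) w := by
    unfold hermNorm hermForm
    simp only [← Complex.reCLM_apply, ← Complex.conjCLE_apply]
    fun_prop
  have h1 : HasDerivAt (fun t : ℝ => w + t • v) v 0 := by
    simpa using! ((hasDerivAt_id (0 : ℝ)).smul_const v).const_add w
  have h2 : HasDerivAt (fun t : ℝ => hermNorm (w + t • v)) (fderiv ℝ hermNorm w v) 0 := by
    have hd' : HasFDerivAt (hermNorm : (Fin (n + 1) → ℂ) → ℝ) (fderiv ℝ hermNorm w)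
      (w + (0 : ℝ) • v) := by simpa using hd.hasFDerivAt
    exact hd'.comp_hasDerivAt (0 : ℝ) h1
  have h3 : ∀ t : ℝ, hermNorm (w + t • v) =
      hermNorm w + t * (2 * (hermForm v w).re) + t ^ 2 * hermNorm v := by
    intro t
    have e : (t • v : Fin (n + 1) → ℂ) = (t : ℂ) • v := by
      ext i; simp
    have hs : (hermForm w v).re = (hermForm v w).re := by
      rw [← hermForm_conj_symm, Complex.conj_re]
    rw [e]
    unfold hermNorm
    simp only [hermForm_add_left, hermForm_add_right, hermForm_smul_left, hermForm_smul_right,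
      Complex.conj_ofReal, Complex.add_re, Complex.re_ofReal_mul, hs]
    ring
  have h4 : HasDerivAt (fun t : ℝ => hermNorm (w + t • v)) (2 * (hermForm v w).re) 0 := by
    simp only [h3]
    have := (((hasDerivAt_id (0 : ℝ)).mul_const (2 * (hermForm v w).re)).const_add
      (hermNorm w)).add (((hasDerivAt_id (0 : ℝ)).pow 2).mul_const (hermNorm v))
    simpa using! this
  exact h2.unique h4

/-- At an isotropic point the polar is the unique tangent hyperplane. -/
lemma isTangentHyperplane_iff {n : ℕ} (hn : 1 ≤ n) {w : Fin (n + 1) → ℂ} (hw : w ≠ 0)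
    (h0 : hermNorm w = 0) (W : Submodule ℂ (Fin (n + 1) → ℂ)) :
    IsTangentHyperplane W (Projectivization.mk ℂ w hw) ↔
      W = polar (Projectivization.mk ℂ w hw) := by
  have hself : hermForm w w = 0 := by rw [hermForm_self, h0, Complex.ofReal_zero]
  constructor
  · rintro ⟨h1, -, h3⟩
    refine Submodule.eq_of_le_of_finrank_eq (fun v hv => ?_) (by rw [h1, finrank_polar hn])
    rw [mem_polar_mk]
    have key : ∀ v ∈ W, (hermForm v w).re = 0 := fun v hv => by
      have := h3 w (by rw [Projectivization.submodule_mk]; exact Submodule.mem_span_singleton_self w)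
        hw v hv
      rw [fderiv_hermNorm_apply] at this
      linarith
    -- The differential sees only real parts. As `W` is a complex subspace, testing it on `I • v`
    -- also kills the imaginary part.
    have hI := key (Complex.I • v) (W.smul_mem _ hv)
    rw [hermForm_smul_left] at hI
    apply Complex.ext
    · exact key v hv
    · simpa using hI
  · rintro rfl
    refine ⟨finrank_polar hn _, ?_, ?_⟩
    · rw [Projectivization.submodule_mk, Submodule.span_singleton_le_iff_mem, mem_polar_mk]
      exact hself
    · intro x hx _ v hv
      rw [fderiv_hermNorm_apply, hv x hx, Complex.zero_re, mul_zero]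

/-! ### The topology of complex projective space -/

lemma continuous_projectivization_mk' (n : ℕ) :
    Continuous (Projectivization.mk' ℂ : {v : Fin (n + 1) → ℂ // v ≠ 0} → ℙ ℂ (Fin (n + 1) → ℂ)) :=
  continuous_quotient_mk'

lemma tendsto_projectivization_mk {n : ℕ} {ι : Type*} {l : Filter ι} {f : ι → Fin (n + 1) → ℂ}
    (hf : ∀ i, f i ≠ 0) {v : Fin (n + 1) → ℂ} (hv : v ≠ 0) (h : Tendsto f l (𝓝 v)) :
    Tendsto (fun i => Projectivization.mk ℂ (f i) (hf i)) l (𝓝 (Projectivization.mk ℂ v hv)) := by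
  have h' : Tendsto (fun i => (⟨f i, hf i⟩ : {v : Fin (n + 1) → ℂ // v ≠ 0})) l (𝓝 ⟨v, hv⟩) :=
    tendsto_subtype_rng.mpr h
  exact ((continuous_projectivization_mk' n).tendsto _).comp h'

/-- The matrix `v v* / (v* v)` of the orthogonal projection onto a line. -/
def lineProjection {n : ℕ} (p : ℙ ℂ (Fin (n + 1) → ℂ)) : Matrix (Fin (n + 1)) (Fin (n + 1)) ℂ :=
  Projectivization.lift
    (fun v : {v : Fin (n + 1) → ℂ // v ≠ 0} =>
      (star v.1 ⬝ᵥ v.1)⁻¹ • vecMulVec v.1 (star v.1))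
    (by
      rintro ⟨a, ha⟩ ⟨b, hb⟩ t h
      simp only at h
      subst h
      have ht : t ≠ 0 := by rintro rfl; simp at ha
      have ht' : conj t ≠ 0 := by simpa using ht
      have hb' : star b ⬝ᵥ b ≠ 0 := star_dotProduct_self_ne_zero hb
      ext i j
      simp [vecMulVec_apply]
      field_simp) p

lemma continuous_lineProjection (n : ℕ) : Continuous (lineProjection (n := n)) := by
  have : Continuous fun v : {v : Fin (n + 1) → ℂ // v ≠ 0} =>
      (star v.1 ⬝ᵥ v.1)⁻¹ • vecMulVec v.1 (star v.1) := by
    have h1 : Continuous fun v : {v : Fin (n + 1) → ℂ // v ≠ 0} => (star v.1 ⬝ᵥ v.1)⁻¹ :=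
      (Continuous.dotProduct continuous_subtype_val.star continuous_subtype_val).inv₀
        fun v => star_dotProduct_self_ne_zero v.2
    exact h1.smul (Continuous.matrix_vecMulVec continuous_subtype_val continuous_subtype_val.star)
  exact this.quotient_lift _

lemma lineProjection_injective (n : ℕ) : Function.Injective (lineProjection (n := n)) := by
  intro p q h
  induction p using Projectivization.ind with | _ v hv =>
  induction q using Projectivization.ind with | _ w hw =>
  have h1 := congrArg (fun M => M *ᵥ v) h
  simp only [lineProjection, Projectivization.lift_mk, smul_mulVec, vecMulVec_mulVec] at h1
  have hv' : star v ⬝ᵥ v ≠ 0 := star_dotProduct_self_ne_zero hv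
  rw [Projectivization.mk_eq_mk_iff']
  refine ⟨(star w ⬝ᵥ w)⁻¹ * (star w ⬝ᵥ v), ?_⟩
  ext i
  have := congrFun h1 i
  simp only [Pi.smul_apply, MulOpposite.smul_eq_mul_unop, MulOpposite.unop_op, smul_eq_mul] at this
  rw [Pi.smul_apply, smul_eq_mul, mul_assoc, mul_comm (star w ⬝ᵥ v), ← this, mul_comm (v i),
    inv_mul_cancel_left₀ hv']

/-- Hausdorffness makes limits of orbits unique and images of compact sets closed. -/
instance projectivization_t2Space (n : ℕ) : T2Space (ℙ ℂ (Fin (n + 1) → ℂ)) :=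
  T2Space.of_injective_continuous (lineProjection_injective n) (continuous_lineProjection n)

/-- The map from the unit sphere (of the supremum norm) onto projective space. -/
def sphereToProjectivization (n : ℕ) (v : Metric.sphere (0 : Fin (n + 1) → ℂ) 1) :
    ℙ ℂ (Fin (n + 1) → ℂ) :=
  Projectivization.mk ℂ v.1 (Metric.ne_of_mem_sphere v.2 one_ne_zero)

lemma continuous_sphereToProjectivization (n : ℕ) : Continuous (sphereToProjectivization n) :=
  (continuous_projectivization_mk' n).comp
    (continuous_subtype_val.subtype_mk (p := fun v => v ≠ 0) fun v =>
      Metric.ne_of_mem_sphere v.2 one_ne_zero)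

lemma sphereToProjectivization_surjective (n : ℕ) :
    Function.Surjective (sphereToProjectivization n) := by
  intro p
  induction p using Projectivization.ind with | _ v hv =>
  refine ⟨⟨((‖v‖⁻¹ : ℝ) : ℂ) • v, ?_⟩, ?_⟩
  · have : ‖v‖ ≠ 0 := by simpa using hv
    simp [norm_smul, this]
  · rw [sphereToProjectivization, Projectivization.mk_eq_mk_iff']
    exact ⟨_, rfl⟩

instance projectivization_compactSpace (n : ℕ) : CompactSpace (ℙ ℂ (Fin (n + 1) → ℂ)) :=
  (sphereToProjectivization_surjective n).compactSpace (continuous_sphereToProjectivization n)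

instance projectivization_firstCountable (n : ℕ) :
    FirstCountableTopology (ℙ ℂ (Fin (n + 1) → ℂ)) :=
  have : FirstCountableTopology (Matrix (Fin (n + 1)) (Fin (n + 1)) ℂ) :=
    inferInstanceAs (FirstCountableTopology (Fin (n + 1) → Fin (n + 1) → ℂ))
  ((continuous_lineProjection n).isClosedEmbedding
    (lineProjection_injective n)).isInducing.firstCountableTopology

/-- The union of the polars of the points of a closed set is closed. -/
lemma isClosed_iUnion_polar {n : ℕ} {S : Set (ℙ ℂ (Fin (n + 1) → ℂ))} (hS : IsClosed S) :
    IsClosed (⋃ p ∈ S, projSet (polar p)) := by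
  let B := Metric.sphere (0 : Fin (n + 1) → ℂ) 1
  -- The incidence relation on pairs of unit vectors is closed in a compact space. The union of
  -- polars is its image under the first projection.
  let C : Set (B × B) := {x | hermForm x.1.1 x.2.1 = 0} ∩
    (fun x => sphereToProjectivization n x.2) ⁻¹' S
  have hC : IsClosed C := by
    refine IsClosed.inter ?_ (hS.preimage
      ((continuous_sphereToProjectivization n).comp continuous_snd))
    have h : Continuous fun x : B × B => ((x.1 : Fin (n + 1) → ℂ), (x.2 : Fin (n + 1) → ℂ)) :=
      (continuous_subtype_val.comp continuous_fst).prodMk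
        (continuous_subtype_val.comp continuous_snd)
    exact isClosed_eq (continuous_hermForm.comp h) continuous_const
  have hinc (v w : B) : sphereToProjectivization n v ∈ projSet (polar
      (sphereToProjectivization n w)) ↔ hermForm v.1 w.1 = 0 := by
    unfold sphereToProjectivization
    rw [mk_mem_projSet, mem_polar_mk]
  have himg : (⋃ p ∈ S, projSet (polar p)) = (fun x => sphereToProjectivization n x.1) '' C := by
    ext q
    simp only [Set.mem_iUnion, exists_prop, Set.mem_image]
    constructor
    · rintro ⟨p, hp, hq⟩
      obtain ⟨v, rfl⟩ := sphereToProjectivization_surjective n q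
      obtain ⟨w, rfl⟩ := sphereToProjectivization_surjective n p
      rw [hinc] at hq
      exact ⟨(v, w), ⟨hq, hp⟩, rfl⟩
    · rintro ⟨⟨v, w⟩, ⟨hq, hp⟩, rfl⟩
      refine ⟨_, hp, ?_⟩
      rwa [hinc]
  rw [himg]
  exact (hC.isCompact.image
    ((continuous_sphereToProjectivization n).comp continuous_fst)).isClosed

/-! ### Complex hyperbolic space and the Chen–Greenberg limit set -/

lemma mk_mem_complexHyperbolicSpace {n : ℕ} {w : Fin (n + 1) → ℂ} (hw : w ≠ 0) :
    Projectivization.mk ℂ w hw ∈ complexHyperbolicSpace n ↔ hermNorm w < 0 := by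
  obtain ⟨a, ha⟩ := Projectivization.exists_smul_eq_mk_rep ℂ w hw
  rw [complexHyperbolicSpace, Set.mem_ofPred_eq, ← ha, Units.smul_def, hermNorm_smul]
  have : 0 < ‖(a : ℂ)‖ ^ 2 := pow_pos (norm_pos_iff.mpr a.ne_zero) 2
  constructor
  · intro h; by_contra! h'; nlinarith [mul_nonneg this.le h']
  · intro h; exact mul_neg_of_pos_of_neg this h

lemma isOpen_complexHyperbolicSpace (n : ℕ) : IsOpen (complexHyperbolicSpace n) := by
  have hq : IsQuotientMap (Projectivization.mk' ℂ :
      {v : Fin (n + 1) → ℂ // v ≠ 0} → ℙ ℂ (Fin (n + 1) → ℂ)) := isQuotientMap_quotient_mk'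
  rw [← hq.isOpen_preimage]
  have : Projectivization.mk' ℂ ⁻¹' complexHyperbolicSpace n =
      {v : {v : Fin (n + 1) → ℂ // v ≠ 0} | hermNorm v.1 < 0} := by
    ext v
    exact mk_mem_complexHyperbolicSpace v.2
  rw [this]
  exact isOpen_lt (continuous_hermNorm.comp continuous_subtype_val) continuous_const

/-- Hyperbolic space is open, which excludes negative vectors. It lies in the compact image of the
unit vectors of nonpositive norm, which excludes positive ones. -/
lemma hermNorm_eq_zero_of_mem_frontier {n : ℕ} {w : Fin (n + 1) → ℂ} (hw : w ≠ 0)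
    (h : Projectivization.mk ℂ w hw ∈ frontier (complexHyperbolicSpace n)) : hermNorm w = 0 := by
  rw [(isOpen_complexHyperbolicSpace n).frontier_eq] at h
  refine le_antisymm ?_ (not_lt.mp fun h' => h.2 ((mk_mem_complexHyperbolicSpace hw).mpr h'))
  let B := Metric.sphere (0 : Fin (n + 1) → ℂ) 1
  have hcl : IsClosed (sphereToProjectivization n '' {v : B | hermNorm v.1 ≤ 0}) :=
    ((isClosed_le (continuous_hermNorm.comp continuous_subtype_val)
      continuous_const).isCompact.image (continuous_sphereToProjectivization n)).isClosed
  have hsub : complexHyperbolicSpace n ⊆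
      sphereToProjectivization n '' {v : B | hermNorm v.1 ≤ 0} := by
    intro q hq
    obtain ⟨v, rfl⟩ := sphereToProjectivization_surjective n q
    exact ⟨v, ((mk_mem_complexHyperbolicSpace _).mp hq).le, rfl⟩
  obtain ⟨v, hv, he⟩ := closure_minimal hsub hcl h.1
  rw [sphereToProjectivization, Projectivization.mk_eq_mk_iff'] at he
  obtain ⟨a, ha⟩ := he
  have hv' : hermNorm v.1 ≤ 0 := hv
  rw [← ha, hermNorm_smul] at hv'
  have ha0 : a ≠ 0 := by
    rintro rfl
    rw [zero_smul] at ha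
    exact Metric.ne_of_mem_sphere v.2 one_ne_zero ha.symm
  have : 0 < ‖a‖ ^ 2 := by positivity
  by_contra! h'
  nlinarith [mul_pos this h']

lemma isClosed_chenGreenbergLimitSet {n : ℕ} (Γ : Subgroup PSL(n + 1, ℂ))
    (z : ℙ ℂ (Fin (n + 1) → ℂ)) : IsClosed (chenGreenbergLimitSet Γ z) :=
  isClosed_frontier.inter (isClosed_derivedSet _)

/-- Points outside hyperbolic space that are limits of the orbit belong to the limit set. -/
lemma mem_chenGreenbergLimitSet {n : ℕ} {Γ : Subgroup PSL(n + 1, ℂ)}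
    {z p : ℙ ℂ (Fin (n + 1) → ℂ)} (ho : MulAction.orbit Γ z ⊆ complexHyperbolicSpace n)
    (hp : p ∉ complexHyperbolicSpace n) (hc : p ∈ closure (MulAction.orbit Γ z)) :
    p ∈ chenGreenbergLimitSet Γ z := by
  refine ⟨?_, ?_⟩
  · rw [(isOpen_complexHyperbolicSpace n).frontier_eq]
    exact ⟨closure_mono ho hc, hp⟩
  -- The orbit stays in hyperbolic space and so avoids `p`; deleting `p` from it changes nothing.
  · rw [accPt_iff_clusterPt, inf_principal, ← mem_closure_iff_clusterPt, Set.inter_comm,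
      ← Set.sdiff_eq, Set.sdiff_singleton_eq_self fun h => hp (ho h)]
    exact hc

/-! ### Lifts of elements of `PU(1,n)` -/

/-- Every lift to `SL(n+1,ℂ)` of an element of `PU(1,n)` preserves the Hermitian form. -/
lemma preservesHermForm_of_mem_projUnitaryGroup {n : ℕ} (hn : 1 ≤ n)
    {A : Matrix.SpecialLinearGroup (Fin (n + 1)) ℂ}
    (h : (A : PSL(n + 1, ℂ)) ∈ projUnitaryGroup n) :
    PreservesHermForm (A : Matrix (Fin (n + 1)) (Fin (n + 1)) ℂ) := by
  obtain ⟨B, hB, hBA⟩ := Subgroup.mem_map.mp (Subgroup.mem_comap.mp h)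
  rw [Matrix.ProjectiveSpecialLinearGroup.toPGL_mk, Matrix.ProjGenLinGroup.mk_eq_mk_iff] at hBA
  obtain ⟨c, hc⟩ := hBA
  have hBp : PreservesHermForm (B : Matrix (Fin (n + 1)) (Fin (n + 1)) ℂ) := hB
  have hA : (A : Matrix (Fin (n + 1)) (Fin (n + 1)) ℂ) = (c : ℂ) • B.1 := by
    have := congrArg Units.val hc
    rw [Units.val_mul] at this
    exact this.symm.trans (by
      ext i j
      simp [mul_comm])
  -- With `A = c • B`, it suffices that `‖c‖ = 1`. Determinants in `Bᴴ J B = J` give `‖det B‖ = 1`,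
  -- and `det A = 1` then gives `‖c‖ ^ (n + 1) = 1`.
  have hdetJ : (formMatrix n).det ≠ 0 := by
    intro h0
    have := congrArg Matrix.det (formMatrix_mul_self n)
    simp [h0] at this
  have hdetB : ‖B.1.det‖ = 1 := by
    have := congrArg Matrix.det (hBp.conjTranspose_mul_mul hn)
    rw [det_mul, det_mul, det_conjTranspose] at this
    have h1 : star B.1.det * B.1.det = 1 := by
      apply mul_left_cancel₀ hdetJ
      linear_combination this
    have h2 := congrArg norm h1
    rw [norm_mul, norm_star, norm_one] at h2
    nlinarith [norm_nonneg B.1.det]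
  have hcn : ‖(c : ℂ)‖ = 1 := by
    have := congrArg (fun M => ‖Matrix.det M‖) hA
    simp only [A.2, det_smul, norm_mul, hdetB, norm_one, mul_one, norm_pow,
      Fintype.card_fin] at this
    exact (pow_eq_one_iff_of_nonneg (norm_nonneg _) (Nat.succ_ne_zero n)).mp this.symm
  intro u v
  rw [hA, smul_mulVec, smul_mulVec, hermForm_smul_left, hermForm_smul_right, hBp, ← mul_assoc,
    Complex.mul_conj', hcn]
  simp

lemma specialLinear_smul_mk {n : ℕ} (A : Matrix.SpecialLinearGroup (Fin (n + 1)) ℂ)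
    {w : Fin (n + 1) → ℂ} (hw : w ≠ 0) :
    ∃ h : (A : Matrix (Fin (n + 1)) (Fin (n + 1)) ℂ) *ᵥ w ≠ 0,
      (A : PSL(n + 1, ℂ)) • Projectivization.mk ℂ w hw = Projectivization.mk ℂ _ h :=
  ⟨(smul_ne_zero_iff_ne A).mpr hw, rfl⟩

lemma orbit_subset_complexHyperbolicSpace {n : ℕ} (hn : 1 ≤ n) {Γ : Subgroup PSL(n + 1, ℂ)}
    (hPU : Γ ≤ projUnitaryGroup n) {z : ℙ ℂ (Fin (n + 1) → ℂ)}
    (hz : z ∈ complexHyperbolicSpace n) : MulAction.orbit Γ z ⊆ complexHyperbolicSpace n := by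
  rintro _ ⟨⟨g, hg⟩, rfl⟩
  obtain ⟨A, rfl⟩ := QuotientGroup.mk_surjective g
  induction z using Projectivization.ind with | _ w hw =>
  obtain ⟨h, he⟩ := specialLinear_smul_mk A hw
  change (A : PSL(n + 1, ℂ)) • Projectivization.mk ℂ w hw ∈ _
  rw [he, mk_mem_complexHyperbolicSpace,
    (preservesHermForm_of_mem_projUnitaryGroup hn (hPU hg)).hermNorm]
  exact (mk_mem_complexHyperbolicSpace hw).mp hz

/-! ### Simply divergent sequences in `PU(1,n)` -/

lemma unitary_of_tendsto {m : Type*} [Fintype m] [DecidableEq m] {K : ℕ → Matrix m m ℂ}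
    {L : Matrix m m ℂ} (hK : ∀ k, K k ∈ Matrix.unitaryGroup m ℂ) (h : Tendsto K atTop (𝓝 L)) :
    L ∈ Matrix.unitaryGroup m ℂ := by
  rw [Matrix.mem_unitaryGroup_iff]
  have h1 : Continuous fun M : Matrix m m ℂ => M * star M :=
    continuous_id.matrix_mul continuous_id.matrix_conjTranspose
  have h2 := (h1.tendsto L).comp h
  refine tendsto_nhds_unique h2 (tendsto_const_nhds.congr fun k => ?_)
  exact (Matrix.mem_unitaryGroup_iff.mp (hK k)).symm

lemma tendsto_hermForm_columns {n : ℕ} {K : ℕ → Matrix (Fin (n + 1)) (Fin (n + 1)) ℂ}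
    {L : Matrix (Fin (n + 1)) (Fin (n + 1)) ℂ} (h : Tendsto K atTop (𝓝 L)) (i j : Fin (n + 1)) :
    Tendsto (fun k => hermForm (K k *ᵥ Pi.single i 1) (K k *ᵥ Pi.single j 1)) atTop
      (𝓝 (hermForm (L *ᵥ Pi.single i 1) (L *ᵥ Pi.single j 1))) := by
  have h1 : Continuous fun M : Matrix (Fin (n + 1)) (Fin (n + 1)) ℂ =>
      (M *ᵥ (Pi.single i 1 : Fin (n + 1) → ℂ), M *ᵥ (Pi.single j 1 : Fin (n + 1) → ℂ)) :=
    (continuous_id.matrix_mulVec continuous_const).prodMk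
      (continuous_id.matrix_mulVec continuous_const)
  exact ((continuous_hermForm.comp h1).tendsto L).comp h

namespace SimplyDivergentSequence

variable {n : ℕ} {Γ : Subgroup PSL(n + 1, ℂ)}

lemma preserves (a : SimplyDivergentSequence Γ) (hn : 1 ≤ n) (hPU : Γ ≤ projUnitaryGroup n)
    (k : ℕ) : PreservesHermForm (a.lift k : Matrix (Fin (n + 1)) (Fin (n + 1)) ℂ) :=
  preservesHermForm_of_mem_projUnitaryGroup hn (hPU (a.mem k))

lemma eventually_sv (a : SimplyDivergentSequence Γ) (hn : 1 ≤ n) (hPU : Γ ≤ projUnitaryGroup n) :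
    ∀ᶠ k in atTop, 1 < a.sv k 0 ∧ a.sv k 0 * a.sv k (Fin.last n) = 1 ∧
      ∀ i, 0 < i → i < Fin.last n → a.sv k i = 1 := by
  filter_upwards [a.tendsto_sv.eventually_gt_atTop 1] with k hk
  exact ⟨hk, (a.preserves hn hPU k).singular_values hn (a.κ₁_unitary k) (a.κ₂_unitary k)
    (a.decomposition k) (a.sv_pos k) (a.sv_antitone k) hk⟩

/-- For `i` before the last index, `s i * s 0` is eventually `s 0 ^ 2` or `s 0`, never 1;
orthogonality then passes to the limit. The case `i = 0` says that the first columns are isotropic.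
-/
lemma limit_columns_orthogonal (a : SimplyDivergentSequence Γ) (hn : 1 ≤ n)
    (hPU : Γ ≤ projUnitaryGroup n) {i : Fin (n + 1)} (hi : i < Fin.last n) :
    hermForm (a.κ₁Lim *ᵥ Pi.single i 1) (a.κ₁Lim *ᵥ Pi.single 0 1) = 0 ∧
      hermForm (a.κ₂Limᴴ *ᵥ Pi.single i 1) (a.κ₂Limᴴ *ᵥ Pi.single 0 1) = 0 := by
  have hev : ∀ᶠ k in atTop, hermForm (a.κ₁ k *ᵥ Pi.single i 1) (a.κ₁ k *ᵥ Pi.single 0 1) = 0 ∧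
      hermForm ((a.κ₂ k)ᴴ *ᵥ Pi.single i 1) ((a.κ₂ k)ᴴ *ᵥ Pi.single 0 1) = 0 := by
    filter_upwards [a.eventually_sv hn hPU] with k ⟨hk, _, hk'⟩
    refine (a.preserves hn hPU k).column_orthogonal hn (a.κ₁_unitary k) (a.κ₂_unitary k)
      (a.decomposition k) (a.sv_pos k) ?_
    rcases eq_or_ne i 0 with rfl | h0
    · nlinarith
    · rw [hk' i (Fin.pos_iff_ne_zero.mpr h0) hi]
      linarith
  have hc : Tendsto (fun k => (a.κ₂ k)ᴴ) atTop (𝓝 a.κ₂Limᴴ) :=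
    ((continuous_id.matrix_conjTranspose).tendsto a.κ₂Lim).comp a.tendsto_κ₂
  constructor
  · exact tendsto_nhds_unique (tendsto_hermForm_columns a.tendsto_κ₁ i 0)
      (tendsto_const_nhds.congr' (hev.mono fun k hk => hk.1.symm))
  · exact tendsto_nhds_unique (tendsto_hermForm_columns hc i 0)
      (tendsto_const_nhds.congr' (hev.mono fun k hk => hk.2.symm))

lemma κ₁Lim_unitary (a : SimplyDivergentSequence Γ) :
    a.κ₁Lim ∈ Matrix.unitaryGroup (Fin (n + 1)) ℂ :=
  unitary_of_tendsto a.κ₁_unitary a.tendsto_κ₁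

lemma κ₂Lim_unitary (a : SimplyDivergentSequence Γ) :
    a.κ₂Lim ∈ Matrix.unitaryGroup (Fin (n + 1)) ℂ :=
  unitary_of_tendsto a.κ₂_unitary a.tendsto_κ₂

/-- The attracting point of a simply divergent sequence in `PU(1,n)`. -/
def attractor (a : SimplyDivergentSequence Γ) : ℙ ℂ (Fin (n + 1) → ℂ) :=
  Projectivization.mk ℂ (a.κ₁Lim *ᵥ Pi.single 0 1) (unitary_mulVec_single_ne_zero a.κ₁Lim_unitary 0)

lemma tendsto_sv_div (a : SimplyDivergentSequence Γ) (hn : 1 ≤ n) (hPU : Γ ≤ projUnitaryGroup n)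
    {i : Fin (n + 1)} (hi : i ≠ 0) : Tendsto (fun k => a.sv k i / a.sv k 0) atTop (𝓝 0) := by
  refine squeeze_zero' (Eventually.of_forall fun k => (div_pos (a.sv_pos k i) (a.sv_pos k 0)).le)
    ?_ a.tendsto_sv.inv_tendsto_atTop
  filter_upwards [a.eventually_sv hn hPU] with k ⟨hk, hl, hm⟩
  rw [Pi.inv_apply, ← one_div]
  refine div_le_div_of_nonneg_right ?_ (a.sv_pos k 0).le
  rcases eq_or_ne i (Fin.last n) with rfl | h
  · nlinarith [a.sv_pos k (Fin.last n)]
  · exact (hm i (Fin.pos_iff_ne_zero.mpr hi) (Fin.lt_last_iff_ne_last.mpr h)).le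

/-- If `0 < m`, the index `m` lies in the block of singular values equal to 1, which extends up to
the last index excluded. If `n = 1` that block is empty and `m = 0` already gives the first `n`
columns. -/
lemma limitSubspace_eq_polar (a : SimplyDivergentSequence Γ) (hn : 1 ≤ n)
    (hPU : Γ ≤ projUnitaryGroup n) {m : Fin (n + 1)} (hm : m < Fin.last n)
    (hm0 : 0 < m ∨ n = 1) : a.limitSubspace m = polar a.attractor := by
  have h0l : (Fin.last n) ≠ 0 := (Fin.pos_of_ne_zero (by
    intro h; have := congrArg Fin.val h; simp at this; omega)).ne'
  have hset : ∀ i : Fin (n + 1), (i ≤ m ∨ a.SameBlock i m) ↔ i < Fin.last n := by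
    intro i
    constructor
    · rintro (h | ⟨c, hc, hlim⟩)
      · exact h.trans_lt hm
      · refine Fin.lt_last_iff_ne_last.mpr ?_
        rintro rfl
        have h2 : Tendsto (fun k => a.sv k (Fin.last n) / a.sv k m) atTop (𝓝 0) := by
          rcases hm0 with hm0 | rfl
          · have h3 : Tendsto (fun k => a.sv k (Fin.last n)) atTop (𝓝 0) := by
              refine Tendsto.congr' ?_ a.tendsto_sv.inv_tendsto_atTop
              filter_upwards [a.eventually_sv hn hPU] with k ⟨hk, hl, _⟩
              exact inv_eq_of_mul_eq_one_right hl
            refine h3.congr' ?_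
            filter_upwards [a.eventually_sv hn hPU] with k ⟨_, _, hk⟩
            rw [hk m hm0 hm, div_one]
          · have : m = 0 := by
              apply Fin.ext
              have := Fin.lt_def.mp hm
              simp at this ⊢
              omega
            subst this
            exact a.tendsto_sv_div hn hPU h0l
        exact hc.ne' (tendsto_nhds_unique hlim h2)
    · intro hi
      by_cases him : i ≤ m
      · exact Or.inl him
      · right
        push Not at him
        rcases hm0 with hm0 | rfl
        · refine ⟨1, one_pos, tendsto_const_nhds.congr' ?_⟩
          filter_upwards [a.eventually_sv hn hPU] with k ⟨_, _, hk⟩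
          rw [hk m hm0 hm, hk i (hm0.trans him) hi, div_one]
        · have h1 := Fin.lt_def.mp hi
          have h2 := Fin.lt_def.mp him
          simp at h1
          omega
  have hU : a.κ₁Limᴴ * a.κ₁Lim = 1 := Matrix.mem_unitaryGroup_iff'.mp a.κ₁Lim_unitary
  have hspan : a.limitSubspace m = Submodule.span ℂ
      (Set.range fun i : Fin n => a.κ₁Lim *ᵥ Pi.single i.castSucc 1) := by
    unfold limitSubspace
    congr 1
    ext v
    simp only [Set.mem_ofPred_eq, hset, Set.mem_range]
    constructor
    · rintro ⟨i, hi, rfl⟩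
      exact ⟨i.castPred hi.ne, by rw [Fin.castSucc_castPred]⟩
    · rintro ⟨i, rfl⟩
      exact ⟨i.castSucc, Fin.castSucc_lt_last i, rfl⟩
  have hli : LinearIndependent ℂ fun i : Fin n => a.κ₁Lim *ᵥ Pi.single i.castSucc 1 := by
    have h1 : LinearIndependent ℂ fun i : Fin n =>
        (Pi.single i.castSucc 1 : Fin (n + 1) → ℂ) :=
      (Pi.linearIndependent_single_one (Fin (n + 1)) ℂ).comp _ (Fin.castSucc_injective n)
    refine h1.map' a.κ₁Lim.mulVecLin (LinearMap.ker_eq_bot.mpr fun u v huv => ?_)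
    have := congrArg (fun x => a.κ₁Limᴴ *ᵥ x) huv
    simpa [mulVec_mulVec, hU] using this
  refine Submodule.eq_of_le_of_finrank_eq ?_ ?_
  · rw [hspan, Submodule.span_le]
    rintro _ ⟨i, rfl⟩
    rw [SetLike.mem_coe, attractor, mem_polar_mk]
    exact (a.limit_columns_orthogonal hn hPU (Fin.castSucc_lt_last i)).1
  · rw [hspan, finrank_span_eq_card hli, Fintype.card_fin, finrank_polar hn]

/-- Orbits of points of complex hyperbolic space converge to the attracting point. -/
lemma tendsto_lift_smul (a : SimplyDivergentSequence Γ) (hn : 1 ≤ n)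
    (hPU : Γ ≤ projUnitaryGroup n) {z : ℙ ℂ (Fin (n + 1) → ℂ)}
    (hz : z ∈ complexHyperbolicSpace n) :
    Tendsto (fun k => (a.lift k : PSL(n + 1, ℂ)) • z) atTop (𝓝 a.attractor) := by
  have h0l : (0 : Fin (n + 1)) < Fin.last n := Fin.pos_of_ne_zero (by
    intro h; have := congrArg Fin.val h; simp at this; omega)
  induction z using Projectivization.ind with | _ w hw =>
  have hwneg := (mk_mem_complexHyperbolicSpace hw).mp hz
  choose hne he using fun k => specialLinear_smul_mk (a.lift k) hw
  have hU : a.κ₂Lim * a.κ₂Limᴴ = 1 := Matrix.mem_unitaryGroup_iff.mp a.κ₂Lim_unitary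
  set x := a.κ₂Limᴴ *ᵥ (Pi.single 0 1 : Fin (n + 1) → ℂ) with hx
  have hx0 : x ≠ 0 := by
    intro h
    have := congrFun (congrArg (fun v => a.κ₂Lim *ᵥ v) h) 0
    simp only [hx, mulVec_mulVec, hU, one_mulVec, mulVec_zero] at this
    simp at this
  -- This coordinate is `star x ⬝ᵥ w`, the form applied to `w` and `J x`. Since `J x` is isotropic
  -- and nonzero, it cannot be orthogonal to the negative vector `w`.
  have hc : (a.κ₂Lim *ᵥ w) 0 ≠ 0 := by
    have hJx0 : formMatrix n *ᵥ x ≠ 0 := by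
      intro h
      have := congrArg (fun v => formMatrix n *ᵥ v) h
      simp only [mulVec_mulVec, formMatrix_mul_self, one_mulVec, mulVec_zero] at this
      exact hx0 this
    have hJ : hermForm (formMatrix n *ᵥ x) (formMatrix n *ᵥ x) = 0 := by
      rw [hermForm_eq_dotProduct hn, star_mulVec, formMatrix_conjTranspose, mulVec_mulVec,
        formMatrix_mul_self, one_mulVec, ← dotProduct_mulVec, ← hermForm_eq_dotProduct hn]
      exact (a.limit_columns_orthogonal hn hPU h0l).2
    have := hermForm_ne_zero_of_neg hwneg hJx0 (by rw [hermNorm, hJ, Complex.zero_re])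
    rw [hermForm_eq_dotProduct hn, star_mulVec, formMatrix_conjTranspose, ← dotProduct_mulVec,
      mulVec_mulVec, formMatrix_mul_self, one_mulVec, hx, star_mulVec, conjTranspose_conjTranspose,
      ← dotProduct_mulVec, Pi.star_single, star_one, single_one_dotProduct] at this
    exact this
  -- After division by the largest singular value the diagonal factor tends to the projection onto
  -- the first coordinate.
  have hD : Tendsto (fun k => Matrix.diagonal fun i => ((a.sv k i / a.sv k 0 : ℝ) : ℂ)) atTop
      (𝓝 (Matrix.diagonal (Pi.single 0 1 : Fin (n + 1) → ℂ))) := by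
    refine ((continuous_id.matrix_diagonal).tendsto _).comp (tendsto_pi_nhds.mpr fun i => ?_)
    change Tendsto (fun k => ((a.sv k i / a.sv k 0 : ℝ) : ℂ)) atTop
      (𝓝 ((Pi.single 0 1 : Fin (n + 1) → ℂ) i))
    rcases eq_or_ne i 0 with rfl | hi
    · rw [Pi.single_eq_same]
      exact tendsto_const_nhds.congr fun k => by rw [div_self (a.sv_pos k 0).ne', Complex.ofReal_one]
    · rw [Pi.single_eq_of_ne hi, ← Complex.ofReal_zero]
      exact (Complex.continuous_ofReal.tendsto 0).comp (a.tendsto_sv_div hn hPU hi)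
  have hcont : Continuous fun M : Matrix (Fin (n + 1)) (Fin (n + 1)) ℂ ×
      Matrix (Fin (n + 1)) (Fin (n + 1)) ℂ × Matrix (Fin (n + 1)) (Fin (n + 1)) ℂ =>
      (M.1 * M.2.1 * M.2.2) *ᵥ w := by fun_prop
  have hlim := (hcont.tendsto _).comp (a.tendsto_κ₁.prodMk_nhds (hD.prodMk_nhds a.tendsto_κ₂))
  set v : ℕ → Fin (n + 1) → ℂ :=
    fun k => ((a.sv k 0 : ℂ)⁻¹) • ((a.lift k : Matrix (Fin (n + 1)) (Fin (n + 1)) ℂ) *ᵥ w) with hv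
  have hsv : ∀ k, (a.sv k 0 : ℂ)⁻¹ ≠ 0 := fun k =>
    inv_ne_zero (Complex.ofReal_ne_zero.mpr (a.sv_pos k 0).ne')
  have hv0 : ∀ k, v k ≠ 0 := fun k => smul_ne_zero (hsv k) (hne k)
  have hvlim : Tendsto v atTop (𝓝 ((a.κ₂Lim *ᵥ w) 0 • (a.κ₁Lim *ᵥ Pi.single 0 1))) := by
    have e : (a.κ₁Lim * Matrix.diagonal (Pi.single 0 1 : Fin (n + 1) → ℂ) * a.κ₂Lim) *ᵥ w =
        (a.κ₂Lim *ᵥ w) 0 • (a.κ₁Lim *ᵥ Pi.single 0 1) := by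
      rw [← mulVec_mulVec, ← mulVec_mulVec, ← mulVec_smul]
      congr 1
      ext i
      rw [mulVec_diagonal]
      rcases eq_or_ne i 0 with rfl | hi
      · simp
      · simp [hi]
    rw [← e]
    refine hlim.congr fun k => ?_
    simp only [Function.comp_apply, hv, a.decomposition k]
    rw [← smul_mulVec, ← Matrix.smul_mul, ← Matrix.mul_smul]
    congr 3
    ext i j
    by_cases hij : i = j
    · subst hij
      simp [div_eq_inv_mul]
    · simp [hij]
  have hne' : (a.κ₂Lim *ᵥ w) 0 • (a.κ₁Lim *ᵥ (Pi.single 0 1 : Fin (n + 1) → ℂ)) ≠ 0 :=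
    smul_ne_zero hc (unitary_mulVec_single_ne_zero a.κ₁Lim_unitary 0)
  have hfin := tendsto_projectivization_mk hv0 hne' hvlim
  have hatt : a.attractor = Projectivization.mk ℂ _ hne' := by
    rw [attractor, eq_comm, Projectivization.mk_eq_mk_iff']
    exact ⟨_, rfl⟩
  rw [hatt]
  refine hfin.congr fun k => ?_
  rw [he k, Projectivization.mk_eq_mk_iff']
  exact ⟨_, rfl⟩

lemma attractor_mem_chenGreenbergLimitSet (a : SimplyDivergentSequence Γ) (hn : 1 ≤ n)
    (hPU : Γ ≤ projUnitaryGroup n) {z : ℙ ℂ (Fin (n + 1) → ℂ)}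
    (hz : z ∈ complexHyperbolicSpace n) : a.attractor ∈ chenGreenbergLimitSet Γ z := by
  have h0l : (0 : Fin (n + 1)) < Fin.last n := Fin.pos_of_ne_zero (by
    intro h; have := congrArg Fin.val h; simp at this; omega)
  refine mem_chenGreenbergLimitSet (orbit_subset_complexHyperbolicSpace hn hPU hz) ?_ ?_
  · rw [attractor, mk_mem_complexHyperbolicSpace, hermNorm,
      (a.limit_columns_orthogonal hn hPU h0l).1]
    simp
  · exact mem_closure_of_tendsto (a.tendsto_lift_smul hn hPU hz)
      (Eventually.of_forall fun k => ⟨⟨_, a.mem k⟩, rfl⟩)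

end SimplyDivergentSequence

/-! ### Singular value decomposition -/

/-- Singular value decomposition of an invertible matrix, with decreasing singular values. -/
lemma exists_singularValueDecomposition {m : ℕ} (A : Matrix (Fin m) (Fin m) ℂ) (hA : A.det ≠ 0) :
    ∃ (K₁ K₂ : Matrix (Fin m) (Fin m) ℂ) (s : Fin m → ℝ),
      K₁ ∈ Matrix.unitaryGroup (Fin m) ℂ ∧ K₂ ∈ Matrix.unitaryGroup (Fin m) ℂ ∧
      (∀ i, 0 < s i) ∧ Antitone s ∧ A = K₁ * Matrix.diagonal (fun i => (s i : ℂ)) * K₂ := by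
  have hH : (Aᴴ * A).IsHermitian := isHermitian_conjTranspose_mul_self A
  set U : Matrix (Fin m) (Fin m) ℂ := hH.eigenvectorUnitary.1 with hU
  set e := hH.eigenvalues with he
  have hUU : Uᴴ * U = 1 := Matrix.mem_unitaryGroup_iff'.mp hH.eigenvectorUnitary.2
  have hUU' : U * Uᴴ = 1 := mul_eq_one_comm.mp hUU
  have hspec : Uᴴ * (Aᴴ * A) * U = Matrix.diagonal (fun i => (e i : ℂ)) := by
    have h := hH.spectral_theorem
    rw [Unitary.conjStarAlgAut_apply] at h
    rw [h]
    change Uᴴ * (U * Matrix.diagonal (fun i => (e i : ℂ)) * Uᴴ) * U = _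
    rw [mul_assoc, mul_assoc, hUU, mul_one, ← mul_assoc, hUU, one_mul]
  have hepos : ∀ i, 0 < e i := by
    intro i
    refine lt_of_le_of_ne (eigenvalues_conjTranspose_mul_self_nonneg A i) fun h0 => ?_
    have hd := congrArg Matrix.det hspec
    rw [det_diagonal, Finset.prod_eq_zero (Finset.mem_univ i) (by rw [← h0]; simp), det_mul,
      det_mul, det_mul, det_conjTranspose, det_conjTranspose] at hd
    have hUd : U.det ≠ 0 := fun h => by
      have := congrArg Matrix.det hUU'
      simp [h] at this
    simp [hA, hUd] at hd
  -- Sorting the negated eigenvalues lists the eigenvalues in decreasing order.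
  let σ : Equiv.Perm (Fin m) := Tuple.sort fun i => -e i
  have hσ : Monotone ((fun i => -e i) ∘ σ) := Tuple.monotone_sort _
  let s : Fin m → ℝ := fun i => Real.sqrt (e (σ i))
  have hs : ∀ i, 0 < s i := fun i => Real.sqrt_pos.mpr (hepos _)
  have hanti : Antitone s := fun i j hij => Real.sqrt_le_sqrt (by
    have := hσ hij
    simp only [Function.comp_apply] at this
    linarith)
  let V : Matrix (Fin m) (Fin m) ℂ := U.submatrix id σ
  have hVspec : Vᴴ * (Aᴴ * A) * V = Matrix.diagonal (fun i => (s i : ℂ) * s i) := by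
    have : Vᴴ * (Aᴴ * A) * V = (Uᴴ * (Aᴴ * A) * U).submatrix σ σ := by
      ext i j
      simp [V, Matrix.mul_apply]
    rw [this, hspec, submatrix_diagonal_equiv]
    congr 1
    funext i
    simp only [Function.comp_apply, s, ← Complex.ofReal_mul, Real.mul_self_sqrt (hepos _).le]
  have hVV : Vᴴ * V = 1 := by
    have : Vᴴ * V = (Uᴴ * U).submatrix σ σ := by
      ext i j
      simp [V, Matrix.mul_apply]
    rw [this, hUU, submatrix_one_equiv]
  have hVV' : V * Vᴴ = 1 := mul_eq_one_comm.mp hVV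
  let D : Matrix (Fin m) (Fin m) ℂ := Matrix.diagonal (fun i => (s i : ℂ))
  let E : Matrix (Fin m) (Fin m) ℂ := Matrix.diagonal (fun i => ((s i : ℂ))⁻¹)
  have hsc : ∀ i, (s i : ℂ) ≠ 0 := fun i => Complex.ofReal_ne_zero.mpr (hs i).ne'
  have hED : E * D = 1 := by
    simp only [E, D, diagonal_mul_diagonal]
    rw [← diagonal_one]
    congr 1
    funext i
    exact inv_mul_cancel₀ (hsc i)
  have hEs : Eᴴ = E := by
    simp only [E, diagonal_conjTranspose]
    congr 1
    funext i
    simp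
  -- The left factor is `A V D⁻¹`; it is unitary because `Vᴴ Aᴴ A V = D²`.
  refine ⟨A * V * E, Vᴴ, s, ?_, ?_, hs, hanti, ?_⟩
  · rw [Matrix.mem_unitaryGroup_iff', star_eq_conjTranspose]
    calc (A * V * E)ᴴ * (A * V * E) = E * (Vᴴ * (Aᴴ * A) * V) * E := by
          simp only [conjTranspose_mul, hEs, mul_assoc]
      _ = 1 := by
          rw [hVspec]
          simp only [E, diagonal_mul_diagonal]
          rw [← diagonal_one]
          congr 1
          funext i
          field_simp [hsc i]
  · rw [Matrix.mem_unitaryGroup_iff, star_eq_conjTranspose, conjTranspose_conjTranspose, hVV]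
  · change A = A * V * E * D * Vᴴ
    rw [mul_assoc (A * V), hED, mul_one, mul_assoc, hVV', mul_one]

/-! ### Compactness and discreteness -/

lemma exists_tendsto_subseq_of_bounded_entries {m : Type*} [Fintype m] {A : ℕ → Matrix m m ℂ}
    {M : ℝ} (h : ∀ k i j, ‖A k i j‖ ≤ M) :
    ∃ (B : Matrix m m ℂ) (φ : ℕ → ℕ), StrictMono φ ∧ Tendsto (A ∘ φ) atTop (𝓝 B) := by
  have : FirstCountableTopology (Matrix m m ℂ) :=
    inferInstanceAs (FirstCountableTopology (m → m → ℂ))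
  have hc : IsCompact (X := Matrix m m ℂ) (Set.univ.pi fun _ : m => Set.univ.pi fun _ : m =>
      Metric.closedBall (0 : ℂ) M) :=
    isCompact_univ_pi fun _ => isCompact_univ_pi fun _ => isCompact_closedBall 0 M
  obtain ⟨B, -, φ, hφ, hB⟩ := hc.tendsto_subseq (x := A) (fun k i _ j _ => by
    simpa using h k i j)
  exact ⟨B, φ, hφ, hB⟩

/-- A sequence of lifts of distinct elements of a discrete group is unbounded. -/
lemma not_bounded_of_discrete {n : ℕ} {Γ : Subgroup PSL(n + 1, ℂ)} [DiscreteTopology Γ]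
    {A : ℕ → Matrix.SpecialLinearGroup (Fin (n + 1)) ℂ} (hmem : ∀ k, (A k : PSL(n + 1, ℂ)) ∈ Γ)
    (hinj : Function.Injective fun k => (A k : PSL(n + 1, ℂ))) {M : ℝ}
    (hM : ∀ k i j, ‖A k i j‖ ≤ M) : False := by
  obtain ⟨B, φ, hφ, hB⟩ := exists_tendsto_subseq_of_bounded_entries
    (A := fun k => (A k : Matrix (Fin (n + 1)) (Fin (n + 1)) ℂ)) hM
  have hdet : B.det = 1 := by
    have h1 : Continuous fun M : Matrix (Fin (n + 1)) (Fin (n + 1)) ℂ => M.det :=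
      continuous_id.matrix_det
    refine tendsto_nhds_unique ((h1.tendsto B).comp hB) (tendsto_const_nhds.congr fun k => ?_)
    exact (A (φ k)).2.symm
  obtain ⟨B', hB'⟩ : ∃ B' : Matrix.SpecialLinearGroup (Fin (n + 1)) ℂ,
      Tendsto (fun k => A (φ k)) atTop (𝓝 B') := ⟨⟨B, hdet⟩, tendsto_subtype_rng.mpr hB⟩
  -- Quotients of consecutive terms of a convergent sequence tend to 1. In a discrete group one of
  -- them must equal 1, so two terms coincide.
  have hC : Tendsto (fun k => A (φ k) * (A (φ (k + 1)))⁻¹) atTop (𝓝 1) := by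
    have := hB'.mul ((hB'.comp (tendsto_add_atTop_nat 1)).inv)
    rwa [mul_inv_cancel] at this
  have hP : Tendsto (fun k => ((A (φ k) * (A (φ (k + 1)))⁻¹ :
      Matrix.SpecialLinearGroup (Fin (n + 1)) ℂ) : PSL(n + 1, ℂ))) atTop (𝓝 1) :=
    (QuotientGroup.continuous_mk.tendsto (1 : Matrix.SpecialLinearGroup (Fin (n + 1)) ℂ)).comp hC
  obtain ⟨U, hU, hU1⟩ := isOpen_induced_iff.mp (isOpen_discrete ({1} : Set Γ))
  have h1U : (1 : PSL(n + 1, ℂ)) ∈ U := by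
    have : (1 : Γ) ∈ Subtype.val ⁻¹' U := by rw [hU1]; rfl
    exact this
  obtain ⟨k, hk⟩ := (hP.eventually (hU.mem_nhds h1U)).exists
  rw [QuotientGroup.mk_mul, QuotientGroup.mk_inv] at hk
  have hin : (⟨_, Γ.mul_mem (hmem (φ k)) (Γ.inv_mem (hmem (φ (k + 1))))⟩ : Γ) ∈
      Subtype.val ⁻¹' U := hk
  rw [hU1, Set.mem_singleton_iff, Subtype.ext_iff] at hin
  have := hφ.injective (hinj (mul_inv_eq_one.mp hin))
  omega

lemma norm_entry_le_of_decomposition {m : ℕ} {A K₁ K₂ : Matrix (Fin m) (Fin m) ℂ}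
    {s : Fin m → ℝ} {M : ℝ} (h₁ : K₁ ∈ Matrix.unitaryGroup (Fin m) ℂ)
    (h₂ : K₂ ∈ Matrix.unitaryGroup (Fin m) ℂ)
    (hd : A = K₁ * Matrix.diagonal (fun i => (s i : ℂ)) * K₂) (hs : ∀ i, 0 < s i)
    (hM : ∀ i, s i ≤ M) (i j : Fin m) : ‖A i j‖ ≤ m * M := by
  rw [hd, Matrix.mul_apply]
  refine (norm_sum_le _ _).trans ?_
  have : ∀ l ∈ Finset.univ, ‖(K₁ * Matrix.diagonal (fun i => (s i : ℂ))) i l * K₂ l j‖ ≤ M := by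
    intro l _
    rw [mul_diagonal, norm_mul, norm_mul, Complex.norm_real, Real.norm_of_nonneg (hs l).le]
    have a1 := entry_norm_bound_of_unitary h₁ i l
    have a2 := entry_norm_bound_of_unitary h₂ l j
    calc ‖K₁ i l‖ * s l * ‖K₂ l j‖ ≤ 1 * s l * 1 := by
          have := (hs l).le
          gcongr
      _ ≤ M := by rw [one_mul, mul_one]; exact hM l
  refine (Finset.sum_le_sum this).trans ?_
  simp

/-! ### Realizing limit points -/

/-- A sequence that avoids its limit has a subsequence without repetitions. -/
lemma exists_injective_subseq {X : Type*} [TopologicalSpace X] [T1Space X] {x : ℕ → X} {p : X}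
    (hx : Tendsto x atTop (𝓝 p)) (hne : ∀ k, x k ≠ p) :
    ∃ φ : ℕ → ℕ, StrictMono φ ∧ Function.Injective (x ∘ φ) := by
  -- Finitely many chosen terms all differ from `p`, so the tail of the sequence avoids them.
  obtain ⟨φ, -, hφ⟩ := exists_seq_of_forall_finset_exists (fun _ : ℕ => True)
    (fun i j => i < j ∧ x i ≠ x j) (fun s _ => by
      have h1 : ∀ᶠ k in atTop, ∀ i ∈ s, i < k ∧ x i ≠ x k := by
        rw [Filter.eventually_all_finset]
        intro i _
        filter_upwards [eventually_gt_atTop i,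
          hx.eventually (isOpen_ne.mem_nhds (hne i).symm)] with k h1 h2
        exact ⟨h1, Ne.symm h2⟩
      obtain ⟨k, hk⟩ := h1.exists
      exact ⟨k, trivial, hk⟩)
  refine ⟨φ, strictMono_nat_of_lt_succ fun k => (hφ k (k + 1) (Nat.lt_succ_self k)).1, ?_⟩
  intro i j hij
  rcases lt_trichotomy i j with h | h | h
  · exact absurd hij (hφ i j h).2
  · exact h
  · exact absurd hij.symm (hφ j i h).2

/-- For `λ, 1, …, 1, λ⁻¹` the consecutive quotients are `λ` at both ends and 1 in between, or the
single quotient `λ²` when `n = 1`. -/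
lemma quotients_of_singular_values {n : ℕ} {s : ℕ → Fin (n + 1) → ℝ}
    (hs : ∀ k i, 0 < s k i) (ht : Tendsto (fun k => s k 0) atTop atTop)
    (h : ∀ᶠ k in atTop, s k 0 * s k (Fin.last n) = 1 ∧
      ∀ i, 0 < i → i < Fin.last n → s k i = 1) (i : Fin n) :
    (∃ c : ℝ, Tendsto (fun k => s k i.castSucc / s k i.succ) atTop (𝓝 c)) ∨
      Tendsto (fun k => s k i.castSucc / s k i.succ) atTop atTop := by
  by_cases h0 : i.castSucc = 0 <;> by_cases hl : i.succ = Fin.last n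
  · right
    refine (ht.atTop_mul_atTop₀ ht).congr' ?_
    filter_upwards [h] with k hk
    rw [h0, hl, eq_div_iff (hs k _).ne', mul_assoc, hk.1, mul_one]
  · right
    refine ht.congr' ?_
    filter_upwards [h] with k hk
    rw [h0, hk.2 i.succ (Fin.succ_pos i) (Fin.lt_last_iff_ne_last.mpr hl), div_one]
  · right
    refine ht.congr' ?_
    filter_upwards [h] with k hk
    rw [hl, hk.2 _ (Fin.pos_iff_ne_zero.mpr h0) (Fin.castSucc_lt_last i),
      eq_div_iff (hs k _).ne', hk.1]
  · left
    refine ⟨1, tendsto_const_nhds.congr' ?_⟩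
    filter_upwards [h] with k hk
    rw [hk.2 i.succ (Fin.succ_pos i) (Fin.lt_last_iff_ne_last.mpr hl),
      hk.2 _ (Fin.pos_iff_ne_zero.mpr h0) (Fin.castSucc_lt_last i), div_one]

/-- Every Chen–Greenberg limit point is the attracting point of a simply divergent sequence. -/
lemma exists_attractor_eq {n : ℕ} (hn : 1 ≤ n) {Γ : Subgroup PSL(n + 1, ℂ)}
    (hPU : Γ ≤ projUnitaryGroup n) (hdisc : DiscreteTopology Γ)
    {z : ℙ ℂ (Fin (n + 1) → ℂ)} (hz : z ∈ complexHyperbolicSpace n)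
    {p : ℙ ℂ (Fin (n + 1) → ℂ)} (hp : p ∈ chenGreenbergLimitSet Γ z) :
    ∃ a : SimplyDivergentSequence Γ, a.attractor = p := by
  have hcl : p ∈ closure (MulAction.orbit Γ z \ {p}) := by
    have := hp.2
    rwa [accPt_iff_clusterPt, inf_principal, ← mem_closure_iff_clusterPt, Set.inter_comm,
      ← Set.sdiff_eq] at this
  obtain ⟨x, hx, hxp⟩ := mem_closure_iff_seq_limit.mp hcl
  have hlift : ∀ k, ∃ A : Matrix.SpecialLinearGroup (Fin (n + 1)) ℂ,
      (A : PSL(n + 1, ℂ)) ∈ Γ ∧ (A : PSL(n + 1, ℂ)) • z = x k := by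
    intro k
    obtain ⟨⟨g, hg⟩, hgx⟩ := (hx k).1
    obtain ⟨A, rfl⟩ := QuotientGroup.mk_surjective g
    exact ⟨A, hg, hgx⟩
  choose A hA hAx using hlift
  obtain ⟨φ, hφ, hinj⟩ := exists_injective_subseq hxp fun k => (hx k).2
  have hAinj : Function.Injective fun k => (A (φ k) : PSL(n + 1, ℂ)) := by
    intro i j hij
    apply hinj
    simp only [Function.comp_apply, ← hAx]
    exact congrArg (· • z) hij
  have hdec : ∀ k, _ := fun k => exists_singularValueDecomposition
    (A (φ k) : Matrix (Fin (n + 1)) (Fin (n + 1)) ℂ) (by rw [(A (φ k)).2]; exact one_ne_zero)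
  choose K₁ K₂ s h₁ h₂ hs ha hd using hdec
  -- Otherwise a subsequence has bounded singular values, hence bounded entries, against
  -- discreteness.
  have hst : Tendsto (fun k => s k 0) atTop atTop := by
    rw [tendsto_atTop]
    by_contra! hcon
    obtain ⟨M, hM⟩ := hcon
    obtain ⟨ψ, hψ, hb⟩ := extraction_of_frequently_atTop hM
    refine not_bounded_of_discrete (A := fun k => A (φ (ψ k))) (Γ := Γ) (fun k => hA _)
      (hAinj.comp hψ.injective) (M := ((n + 1 : ℕ) : ℝ) * M) fun k i j => ?_
    exact norm_entry_le_of_decomposition (h₁ _) (h₂ _) (hd _) (hs _)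
      (fun i => (ha _ (Fin.zero_le i)).trans (hb k).le) i j
  obtain ⟨L₁, α, hα, hL₁⟩ := exists_tendsto_subseq_of_bounded_entries (A := K₁)
    fun k i j => entry_norm_bound_of_unitary (h₁ k) i j
  obtain ⟨L₂, β, hβ, hL₂⟩ := exists_tendsto_subseq_of_bounded_entries (A := K₂ ∘ α)
    fun k i j => entry_norm_bound_of_unitary (h₂ (α k)) i j
  have hst' : Tendsto (fun k => s (α (β k)) 0) atTop atTop :=
    hst.comp (hα.comp hβ).tendsto_atTop
  have hev : ∀ᶠ k in atTop, s (α (β k)) 0 * s (α (β k)) (Fin.last n) = 1 ∧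
      ∀ i, 0 < i → i < Fin.last n → s (α (β k)) i = 1 := by
    filter_upwards [hst'.eventually_gt_atTop 1] with k hk
    exact (preservesHermForm_of_mem_projUnitaryGroup hn (hPU (hA _))).singular_values hn
      (h₁ _) (h₂ _) (hd _) (hs _) (ha _) hk
  let a : SimplyDivergentSequence Γ :=
    { lift := fun k => A (φ (α (β k)))
      mem := fun k => hA _
      distinct := hAinj.comp (hα.injective.comp hβ.injective)
      κ₁ := fun k => K₁ (α (β k))
      κ₂ := fun k => K₂ (α (β k))
      sv := fun k => s (α (β k))
      κ₁_unitary := fun k => h₁ _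
      κ₂_unitary := fun k => h₂ _
      sv_pos := fun k => hs _
      sv_antitone := fun k => ha _
      decomposition := fun k => hd _
      κ₁Lim := L₁
      κ₂Lim := L₂
      tendsto_κ₁ := hL₁.comp hβ.tendsto_atTop
      tendsto_κ₂ := hL₂
      tendsto_sv := hst'
      quotients := quotients_of_singular_values (fun k => hs _) hst' hev }
  -- The same orbit points converge to the attractor and, by choice, to `p`.
  refine ⟨a, tendsto_nhds_unique (a.tendsto_lift_smul hn hPU hz) ?_⟩
  have hlim : Tendsto (fun k => x (φ (α (β k)))) atTop (𝓝 p) :=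
    hxp.comp (hφ.comp (hα.comp hβ)).tendsto_atTop
  exact hlim.congr fun k => (hAx _).symm

lemma francesLimitSetOfIndex_eq {n : ℕ} (hn : 1 ≤ n) {Γ : Subgroup PSL(n + 1, ℂ)}
    (hPU : Γ ≤ projUnitaryGroup n) (hdisc : DiscreteTopology Γ)
    {z : ℙ ℂ (Fin (n + 1) → ℂ)} (hz : z ∈ complexHyperbolicSpace n)
    {m : Fin (n + 1)} (hm : m < Fin.last n) (hm0 : 0 < m ∨ n = 1) :
    francesLimitSetOfIndex m Γ = ⋃ p ∈ chenGreenbergLimitSet Γ z, projSet (polar p) := by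
  apply Set.Subset.antisymm
  · refine closure_minimal (Set.iUnion_subset fun a => ?_)
      (isClosed_iUnion_polar (isClosed_chenGreenbergLimitSet Γ z))
    rw [a.limitSubspace_eq_polar hn hPU hm hm0]
    exact Set.subset_biUnion_of_mem (u := fun p => projSet (polar p))
      (a.attractor_mem_chenGreenbergLimitSet hn hPU hz)
  · refine Set.iUnion₂_subset fun p hp => ?_
    obtain ⟨a, rfl⟩ := exists_attractor_eq hn hPU hdisc hz hp
    rw [← a.limitSubspace_eq_polar hn hPU hm hm0]
    exact (Set.subset_iUnion (fun a : SimplyDivergentSequence Γ => projSet (a.limitSubspace m))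
      a).trans subset_closure

end

theorem mainTheorem10 (n : ℕ) (hn : 1 ≤ n) (Γ : Subgroup PSL(n + 1, ℂ))
    (hPU : Γ ≤ projUnitaryGroup n) (hdisc : DiscreteTopology Γ)
    (z : ℙ ℂ (Fin (n + 1) → ℂ)) (hz : z ∈ complexHyperbolicSpace n) :
    francesLimitSet Γ = ⋃ p ∈ chenGreenbergLimitSet Γ z, projSet (polar p) ∧
    (∀ p ∈ chenGreenbergLimitSet Γ z, ∀ W : Submodule ℂ (Fin (n + 1) → ℂ),
      IsTangentHyperplane W p ↔ W = polar p) ∧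
    (n ≠ 2 → francesLimitSetOfIndex (lowerMiddleIndex n) Γ =
      ⋃ p ∈ chenGreenbergLimitSet Γ z, projSet (polar p)) := by
  refine ⟨?_, fun p hp W => ?_, fun h2 => ?_⟩
  · refine francesLimitSetOfIndex_eq hn hPU hdisc hz ?_ ?_
    · rw [Fin.lt_def]
      simp only [middleIndex, Fin.val_last]
      omega
    · rw [Fin.lt_def]
      simp only [middleIndex, Fin.val_zero]
      omega
  · induction p using Projectivization.ind with | _ w hw =>
    exact isTangentHyperplane_iff hn hw (hermNorm_eq_zero_of_mem_frontier hw hp.1) W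
  · refine francesLimitSetOfIndex_eq hn hPU hdisc hz ?_ ?_
    · rw [Fin.lt_def]
      simp only [lowerMiddleIndex, Fin.val_last]
      omega
    -- The zero-based index `(n + 1) / 2 - 1` vanishes only for `n = 1` and `n = 2`. For `n = 2` it
    -- would single out the block of the top singular value alone.
    · rw [Fin.lt_def]
      simp only [lowerMiddleIndex, Fin.val_zero]
      omega
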